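/- Let $\Omega\subset\mathbb R^2$ be a bounded simply connected domain whose boundary is a real-analytic Jordan curve, and write $\nabla^\perp=(-\partial_2,\partial_1)$. Let $u=\nabla^\perp\psi$, $B=\nabla^\perp A$ and $p$, with $\psi,A,p$ real analytic on $\overline\Omega$ (i.e. in a neighbourhood of it), be a fixed-boundary steady solution of ideal incompressible MHD, $$u\cdot\nabla u-B\cdot\nabla B=-\nabla p,\qquad u\cdot\nabla B-B\cdot\nabla u=0,\qquad \nabla\cdot B=\nabla\cdot u=0\quad\text{in }\Omega,$$ $$B\cdot\hat n=u\cdot\hat n=0\quad\text{on }\partial\Omega,$$ where $\hat n$ is the outward unit normal and $A$ is normalized by $A=0$ on $\partial\Omega$. Suppose that $B$ vanishes at exactly one point of $\overline\Omega$. Then there are functions $G,H:\mathbb R\to\mathbb R$, with $G$ differentiable at $0$, such that $$\psi=G(A),\qquad p+\tfrac12|u|^2-\tfrac12|B|^2=H(A)\qquad\text{on }\overline\Omega .$$ Moreover, for any such $G,H$, if $$(1-|G'(0)|^2)\,|B|^2>-2H(0)\qquad\text{on }\partial\Omega$$ (which for $|G'(0)|<1$ says $|B|^2>-\frac{2H(0)}{1-|G'(0)|^2}$),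 then there is an external magnetic field, generated by a singular current sheet, that makes $(u,B,\Omega)$ with the pressure $p$ a free-boundary equilibrium. Precisely, there are a smooth Jordan curve $\Gamma$ surrounding $\overline\Omega$ (so $\Gamma\cap\overline\Omega=\emptyset$ and $\overline\Omega$ lies in the bounded part of $\mathbb R^2\setminus\Gamma$), a continuous function $j:\Gamma\to\mathbb R$, and a vector field $B_{\mathsf{ext}}$ on $\mathbb R^2\setminus\Omega$, continuous up to $\partial\Omega$ away from $\Gamma$ and locally integrable in $\mathbb R^2\setminus\overline\Omega$, such that $$\nabla^\perp\cdot B_{\mathsf{ext}}=j\,\delta_\Gamma,\qquad \nabla\cdot B_{\mathsf{ext}}=0\quad\text{in }\mathbb R^2\setminus\overline\Omega\text{ in the sense of distributions},\qquad B_{\mathsf{ext}}(x)\to0\ \text{ as }|x|\to\infty,$$ $$p=\tfrac12|B_{\mathsf{ext}}|^2,\qquad B\cdot\hat n=B_{\mathsf{ext}}\cdot\hat n=0,\qquad u\cdot\hat n=0\qquad\text{on }\partial\Omega .$$ -/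

import Mathlib

open Set Filter Topology MeasureTheory
open scoped ContDiff

noncomputable section

namespace PlasmaMHD

/-- The Euclidean plane. -/
abbrev Plane : Type := EuclideanSpace ℝ (Fin 2)

/-- The rotated gradient `∇^⊥ f = (-∂₂ f, ∂₁ f)`. -/
def gradPerp (f : Plane → ℝ) (x : Plane) : Plane :=
  !₂[-(gradient f x 1), gradient f x 0]

/-- The divergence `∂₁ v₁ + ∂₂ v₂` of a planar vector field. -/
def divergence (v : Plane → Plane) (x : Plane) : ℝ :=
  ∑ i : Fin 2, fderiv ℝ v x (EuclideanSpace.single i 1) i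

/-- The advective derivative `(v · ∇) w`. -/
def advect (v w : Plane → Plane) (x : Plane) : Plane :=
  fderiv ℝ w x (v x)

/-- `γ` is a `1`-periodic regular parametrization, of class `C^n`, of a Jordan curve
(`n = ω` means real analytic, `n = ∞` means smooth); the curve is `range γ`. -/
structure IsJordanParam (n : WithTop ℕ∞) (γ : ℝ → Plane) : Prop where
  contDiff : ContDiff ℝ n γ
  periodic : Function.Periodic γ 1
  injOn : InjOn γ (Ico 0 1)
  regular : ∀ t, deriv γ t ≠ 0

/-- `Ω` is a bounded simply connected domain of the plane whose boundary is a
real-analytic Jordan curve. -/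
structure IsAnalyticDomain (Ω : Set Plane) : Prop where
  isOpen : IsOpen Ω
  bounded : Bornology.IsBounded Ω
  simplyConnected : IsSimplyConnected Ω
  boundary : ∃ γ : ℝ → Plane, IsJordanParam ω γ ∧ range γ = frontier Ω

/-- `n` is the outward unit normal to `∂Ω` at the boundary point `x`: short segments leaving `x`
in a direction `v` enter `Ω` if `v · n < 0` and leave the closure of `Ω` if `v · n > 0`. -/
structure IsOutwardUnitNormal (Ω : Set Plane) (x n : Plane) : Prop where
  norm_eq : ‖n‖ = 1
  inward : ∀ v : Plane, inner ℝ v n < 0 → ∀ᶠ s : ℝ in 𝓝[>] 0, x + s • v ∈ Ω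
  outward : ∀ v : Plane, 0 < inner ℝ v n → ∀ᶠ s : ℝ in 𝓝[>] 0, x + s • v ∉ closure Ω

/-- The stationary ideal incompressible MHD equations in the interior of `Ω`. -/
structure IsSteadyMHD (Ω : Set Plane) (u B : Plane → Plane) (p : Plane → ℝ) : Prop where
  momentum : ∀ x ∈ Ω, advect u u x - advect B B x = -gradient p x
  induction : ∀ x ∈ Ω, advect u B x - advect B u x = 0
  div_B : ∀ x ∈ Ω, divergence B x = 0
  div_u : ∀ x ∈ Ω, divergence u x = 0

/-- Fixed-boundary steady solutions: both fields are tangent to `∂Ω`, and no condition is imposed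
on the pressure at the boundary. -/
structure IsFixedBoundarySolution (Ω : Set Plane) (u B : Plane → Plane) (p : Plane → ℝ) :
    Prop where
  steady : IsSteadyMHD Ω u B p
  B_tangent : ∀ x ∈ frontier Ω, ∀ n, IsOutwardUnitNormal Ω x n → inner ℝ (B x) n = 0
  u_tangent : ∀ x ∈ frontier Ω, ∀ n, IsOutwardUnitNormal Ω x n → inner ℝ (u x) n = 0

/-- The flux-function profiles of a solution `u = ∇^⊥ ψ`, `B = ∇^⊥ A` with pressure `p`:
`ψ = G(A)` and `p + |u|²/2 - |B|²/2 = H(A)` up to the boundary (where `A = 0`), with `G`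
differentiable at `0`. -/
structure IsProfile (Ω : Set Plane) (A ψ p : Plane → ℝ) (G H : ℝ → ℝ) : Prop where
  differentiableAt : DifferentiableAt ℝ G 0
  stream : ∀ x ∈ closure Ω, ψ x = G (A x)
  bernoulli : ∀ x ∈ closure Ω,
    p x + ‖gradPerp ψ x‖ ^ 2 / 2 - ‖gradPerp A x‖ ^ 2 / 2 = H (A x)

/-- The Jordan curve `range γ` surrounds `Ω`: the closure of `Ω` misses the curve and lies in the
bounded part of its complement. -/
def Surrounds (γ : ℝ → Plane) (Ω : Set Plane) : Prop :=
  ∀ x ∈ closure Ω, x ∉ range γ ∧ Bornology.IsBounded (connectedComponentIn (range γ)ᶜ x)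

/-- The current sheet `j δ_Γ` on the curve `Γ = range γ`, as a distribution:
`φ ↦ ∫_Γ j φ dℓ`. -/
def currentSheet (γ : ℝ → Plane) (j : Plane → ℝ) (φ : Plane → ℝ) : ℝ :=
  ∫ t in (0 : ℝ)..1, j (γ t) * φ (γ t) * ‖deriv γ t‖

/-- `φ` is a smooth function with compact support in the open set `U`. -/
structure IsTest (U : Set Plane) (φ : Plane → ℝ) : Prop where
  smooth : ContDiff ℝ ∞ φ
  compact : HasCompactSupport φ
  support : tsupport φ ⊆ U

/-- `Bext` is a magnetic field outside `Ω` generated by the current sheet `j δ_Γ`, `Γ = range γ`: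
`curl Bext = ∇^⊥ · Bext = j δ_Γ` and `∇ · Bext = 0` as distributions outside `Ω`; off `Γ` the field
is continuous, up to `∂Ω`, and it decays at infinity. -/
structure IsFieldOfCurrentSheet (Ω : Set Plane) (γ : ℝ → Plane) (j : Plane → ℝ)
    (Bext : Plane → Plane) : Prop where
  continuousOn : ContinuousOn Bext (Ωᶜ \ range γ)
  locallyIntegrable : LocallyIntegrableOn Bext (closure Ω)ᶜ
  curl_eq : ∀ φ, IsTest (closure Ω)ᶜ φ →
    -∫ x, inner ℝ (Bext x) (gradPerp φ x) = currentSheet γ j φ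
  div_eq : ∀ φ, IsTest (closure Ω)ᶜ φ → -∫ x, inner ℝ (Bext x) (gradient φ x) = 0
  decay : Tendsto Bext (cocompact Plane) (𝓝 0)

/-- `(u, B, Ω)` with pressure `p` is a steady free-boundary equilibrium in the non-penetrating
external field `Bext`: the interior equations, and on `∂Ω` the conditions `p = |Bext|²/2`,
`B · n = Bext · n = 0` and `u · n = 0`. -/
structure IsFreeBoundaryEquilibrium (Ω : Set Plane) (u B : Plane → Plane) (p : Plane → ℝ)
    (Bext : Plane → Plane) : Prop where
  steady : IsSteadyMHD Ω u B p
  pressure : ∀ x ∈ frontier Ω, p x = ‖Bext x‖ ^ 2 / 2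
  normal_eq : ∀ x ∈ frontier Ω, ∀ n, IsOutwardUnitNormal Ω x n →
    inner ℝ (B x) n = inner ℝ (Bext x) n
  nonpenetrating : ∀ x ∈ frontier Ω, ∀ n, IsOutwardUnitNormal Ω x n → inner ℝ (Bext x) n = 0
  u_tangent : ∀ x ∈ frontier Ω, ∀ n, IsOutwardUnitNormal Ω x n → inner ℝ (u x) n = 0

end PlasmaMHD

end

open PlasmaMHD

noncomputable section

namespace PlasmaMHD

/-! Profiles. A vanishes on the boundary and an interior extremum is a critical point, so a single
critical point x₀ forces A, up to sign, to be positive in Ω with its maximum at x₀ and regular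
elsewhere in the closure (`exists_isFlux`). The induction equation says that the Hamiltonian fields
of A and ψ commute. Their Poisson bracket {A, ψ} is then constant on Ω, and it is 0 because dA = 0
at x₀. The momentum equation gives {A, b} = Δψ {A, ψ} = 0 for the Bernoulli function b. A function
with zero bracket against A is locally constant along the level sets of A. It is therefore a
function of A as soon as these level sets are connected (`IsFlux.isPreconnected_levelSet`). The
boundary level is a Jordan curve, and connectedness is both an open and a closed condition on the
level below the maximum. Differentiability of the profile at 0 is read off along a curve transversal
to the boundary.

External field. On the boundary ∇ψ = G'(0)∇A, so p = H(0) + (1 - G'(0)²)|B|²/2, which the inequality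
makes positive (`pressure_pos`). It remains to find a tangential, curl-free and divergence-free
field of size √(2p) on the boundary. This is a Cauchy problem for the Cauchy-Riemann equations,
solvable near the boundary for analytic data, and a current sheet may cut the solution off as close
to the boundary as needed. Concretely, the boundary is parametrized analytically with speed κ/√(2p)
(`IsJordanParam.exists_reparam`), and the parametrization extends to a conformal map Φ of a thin
strip (`exists_collar`). The field is κ∇(Re Φ⁻¹) on 0 ≤ Im z < δ and zero beyond. It has size κ/|Φ'|
and is tangent to the curves Im z = const. In the coordinates s + iτ its weak divergence and curl
are integrals of ∂_s and ∂_τ: periodicity kills the first, and the second leaves only a current on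
Im z = δ (`IsCollar.exists_field`). -/

/-! ### Vector calculus of stream functions -/

/-- The standard basis vectors of the plane. -/
abbrev unitVec (i : Fin 2) : Plane := EuclideanSpace.single i (1 : ℝ)

/-- The Jacobian determinant `∂₁f ∂₂g - ∂₂f ∂₁g`. -/
def jac (f g : Plane → ℝ) (x : Plane) : ℝ :=
  fderiv ℝ f x (unitVec 0) * fderiv ℝ g x (unitVec 1)
    - fderiv ℝ f x (unitVec 1) * fderiv ℝ g x (unitVec 0)

lemma gradient_coord (f : Plane → ℝ) (x : Plane) (i : Fin 2) :
    gradient f x i = fderiv ℝ f x (unitVec i) := by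
  rw [← inner_gradient_left, EuclideanSpace.inner_single_right]
  simp

lemma gradPerp_coord_zero (f : Plane → ℝ) (x : Plane) :
    gradPerp f x 0 = -fderiv ℝ f x (unitVec 1) := by
  simp [gradPerp, gradient_coord]

lemma gradPerp_coord_one (f : Plane → ℝ) (x : Plane) :
    gradPerp f x 1 = fderiv ℝ f x (unitVec 0) := by
  simp [gradPerp, gradient_coord]

lemma plane_eq_sum (v : Plane) : v = v 0 • unitVec 0 + v 1 • unitVec 1 := by
  ext i; fin_cases i <;> simp [unitVec]

lemma clm_plane_apply {F : Type*} [NormedAddCommGroup F] [NormedSpace ℝ F] (l : Plane →L[ℝ] F)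
    (v : Plane) : l v = v 0 • l (unitVec 0) + v 1 • l (unitVec 1) := by
  conv_lhs => rw [plane_eq_sum v]
  simp

lemma gradPerp_eq_zero_iff (f : Plane → ℝ) (x : Plane) :
    gradPerp f x = 0 ↔ fderiv ℝ f x = 0 := by
  constructor
  · intro h
    have h0 := gradPerp_coord_zero f x
    have h1 := gradPerp_coord_one f x
    rw [h] at h0 h1
    ext v
    rw [clm_plane_apply, ← h1, show fderiv ℝ f x (unitVec 1) = 0 by simpa using h0]
    simp
  · intro h
    ext i
    fin_cases i
    · simp [gradPerp_coord_zero, h]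
    · simp [gradPerp_coord_one, h]

lemma norm_gradPerp_sq (f : Plane → ℝ) (x : Plane) :
    ‖gradPerp f x‖ ^ 2
      = (fderiv ℝ f x (unitVec 0)) ^ 2 + (fderiv ℝ f x (unitVec 1)) ^ 2 := by
  rw [EuclideanSpace.norm_sq_eq, Fin.sum_univ_two, gradPerp_coord_zero, gradPerp_coord_one]
  simp [add_comm]

lemma hasFDerivAt_partial {f : Plane → ℝ} {x : Plane} (hf : AnalyticAt ℝ f x) (w : Plane) :
    HasFDerivAt (fun y => fderiv ℝ f y w)
      ((ContinuousLinearMap.apply ℝ ℝ w).comp (fderiv ℝ (fderiv ℝ f) x)) x :=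
  (ContinuousLinearMap.apply ℝ ℝ w).hasFDerivAt.comp x hf.fderiv.differentiableAt.hasFDerivAt

lemma analyticAt_partial {f : Plane → ℝ} {x : Plane} (hf : AnalyticAt ℝ f x) (w : Plane) :
    AnalyticAt ℝ (fun y => fderiv ℝ f y w) x :=
  ((ContinuousLinearMap.apply ℝ ℝ w).analyticAt _).comp hf.fderiv

lemma snd_fderiv_symm {f : Plane → ℝ} {x : Plane} (hf : AnalyticAt ℝ f x) (v w : Plane) :
    fderiv ℝ (fderiv ℝ f) x v w = fderiv ℝ (fderiv ℝ f) x w v :=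
  (hf.contDiffAt (n := ω)).isSymmSndFDerivAt le_top v w

lemma analyticAt_gradPerp {f : Plane → ℝ} {x : Plane} (hf : AnalyticAt ℝ f x) :
    AnalyticAt ℝ (gradPerp f) x := by
  have : gradPerp f = fun y => (-fderiv ℝ f y (unitVec 1)) • unitVec 0
      + (fderiv ℝ f y (unitVec 0)) • unitVec 1 := by
    funext y
    rw [plane_eq_sum (gradPerp f y), gradPerp_coord_zero, gradPerp_coord_one]
  rw [this]
  exact ((analyticAt_partial hf _).neg.smul analyticAt_const).add
    ((analyticAt_partial hf _).smul analyticAt_const)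

lemma fderiv_gradPerp_coord {f : Plane → ℝ} {x : Plane} (hf : AnalyticAt ℝ f x) (v : Plane) :
    fderiv ℝ (gradPerp f) x v 0 = -fderiv ℝ (fderiv ℝ f) x v (unitVec 1) ∧
    fderiv ℝ (gradPerp f) x v 1 = fderiv ℝ (fderiv ℝ f) x v (unitVec 0) := by
  have hd := (analyticAt_gradPerp hf).differentiableAt.hasFDerivAt
  have key : ∀ i : Fin 2, HasFDerivAt (fun y => gradPerp f y i)
      ((EuclideanSpace.proj i : Plane →L[ℝ] ℝ).comp (fderiv ℝ (gradPerp f) x)) x := fun i =>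
    (EuclideanSpace.proj i : Plane →L[ℝ] ℝ).hasFDerivAt.comp x hd
  constructor
  · have h := key 0
    simp only [gradPerp_coord_zero] at h
    have := congrArg (fun l => l v) (h.unique (hasFDerivAt_partial hf (unitVec 1)).neg)
    simpa using this
  · have h := key 1
    simp only [gradPerp_coord_one] at h
    have := congrArg (fun l => l v) (h.unique (hasFDerivAt_partial hf (unitVec 0)))
    simpa using this

lemma advect_gradPerp_coord {f g : Plane → ℝ} {x : Plane} (hg : AnalyticAt ℝ g x) :
    advect (gradPerp f) (gradPerp g) x 0
      = fderiv ℝ f x (unitVec 1) * fderiv ℝ (fderiv ℝ g) x (unitVec 0) (unitVec 1)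
        - fderiv ℝ f x (unitVec 0) * fderiv ℝ (fderiv ℝ g) x (unitVec 1) (unitVec 1) ∧
    advect (gradPerp f) (gradPerp g) x 1
      = -fderiv ℝ f x (unitVec 1) * fderiv ℝ (fderiv ℝ g) x (unitVec 0) (unitVec 0)
        + fderiv ℝ f x (unitVec 0) * fderiv ℝ (fderiv ℝ g) x (unitVec 1) (unitVec 0) := by
  unfold advect
  obtain ⟨h0, h1⟩ := fderiv_gradPerp_coord hg (gradPerp f x)
  rw [h0, h1, clm_plane_apply (fderiv ℝ (fderiv ℝ g) x), gradPerp_coord_zero, gradPerp_coord_one]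
  simp
  ring

/-! ### Poisson brackets along a steady solution -/

lemma analyticAt_jac {f g : Plane → ℝ} {x : Plane} (hf : AnalyticAt ℝ f x)
    (hg : AnalyticAt ℝ g x) : AnalyticAt ℝ (jac f g) x :=
  ((analyticAt_partial hf _).mul (analyticAt_partial hg _)).sub
    ((analyticAt_partial hf _).mul (analyticAt_partial hg _))

/-- Commuting Hamiltonian fields have a locally constant Poisson bracket. -/
lemma fderiv_jac_eq_zero {f g : Plane → ℝ} {x : Plane} (hf : AnalyticAt ℝ f x)
    (hg : AnalyticAt ℝ g x)
    (h : advect (gradPerp g) (gradPerp f) x - advect (gradPerp f) (gradPerp g) x = 0) :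
    fderiv ℝ (jac f g) x = 0 := by
  have hj := ((hasFDerivAt_partial hf (unitVec 0)).mul (hasFDerivAt_partial hg (unitVec 1))).sub
    ((hasFDerivAt_partial hf (unitVec 1)).mul (hasFDerivAt_partial hg (unitVec 0)))
  have hj' : HasFDerivAt (jac f g) _ x := hj
  obtain ⟨a0, a1⟩ := advect_gradPerp_coord (f := g) hf
  obtain ⟨b0, b1⟩ := advect_gradPerp_coord (f := f) hg
  have e0 : advect (gradPerp g) (gradPerp f) x 0 - advect (gradPerp f) (gradPerp g) x 0 = 0 := by
    simpa using congrArg (fun w : Plane => w 0) h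
  have e1 : advect (gradPerp g) (gradPerp f) x 1 - advect (gradPerp f) (gradPerp g) x 1 = 0 := by
    simpa using congrArg (fun w : Plane => w 1) h
  rw [a0, b0] at e0
  rw [a1, b1] at e1
  have sf := snd_fderiv_symm hf (unitVec 0) (unitVec 1)
  have sg := snd_fderiv_symm hg (unitVec 0) (unitVec 1)
  rw [hj'.fderiv]
  ext v
  rw [clm_plane_apply]
  simp only [sub_apply, add_apply,
    smul_apply, ContinuousLinearMap.comp_apply,
    ContinuousLinearMap.apply_apply, smul_eq_mul, zero_apply]
  -- The gradient of the bracket is the commutator field rotated by a right angle, once mixed second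
  -- derivatives are exchanged.
  linear_combination (-v 0) * e1 + (v 1) * e0 - v 1 * fderiv ℝ g x (unitVec 1) * sf
    + v 1 * fderiv ℝ f x (unitVec 1) * sg + v 0 * fderiv ℝ f x (unitVec 0) * sg
    - v 0 * fderiv ℝ g x (unitVec 0) * sf

/-- The Bernoulli function `p + |∇ψ|²/2 - |∇A|²/2`. -/
def bernoulli (A ψ p : Plane → ℝ) (x : Plane) : ℝ :=
  p x + ‖gradPerp ψ x‖ ^ 2 / 2 - ‖gradPerp A x‖ ^ 2 / 2

lemma analyticAt_bernoulli {A ψ p : Plane → ℝ} {x : Plane} (hA : AnalyticAt ℝ A x)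
    (hψ : AnalyticAt ℝ ψ x) (hp : AnalyticAt ℝ p x) : AnalyticAt ℝ (bernoulli A ψ p) x := by
  have : bernoulli A ψ p = fun y => p y
      + ((fderiv ℝ ψ y (unitVec 0)) ^ 2 + (fderiv ℝ ψ y (unitVec 1)) ^ 2) * 2⁻¹
      - ((fderiv ℝ A y (unitVec 0)) ^ 2 + (fderiv ℝ A y (unitVec 1)) ^ 2) * 2⁻¹ := by
    funext y
    simp only [bernoulli, norm_gradPerp_sq, div_eq_mul_inv]
  rw [this]
  exact (hp.add ((((analyticAt_partial hψ _).pow 2).add ((analyticAt_partial hψ _).pow 2)).mul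
    analyticAt_const)).sub ((((analyticAt_partial hA _).pow 2).add
      ((analyticAt_partial hA _).pow 2)).mul analyticAt_const)

/-- The momentum equation makes the Bernoulli function a flux function. -/
lemma jac_bernoulli_eq_zero {A ψ p : Plane → ℝ} {x : Plane} (hA : AnalyticAt ℝ A x)
    (hψ : AnalyticAt ℝ ψ x) (hp : AnalyticAt ℝ p x)
    (h : advect (gradPerp ψ) (gradPerp ψ) x - advect (gradPerp A) (gradPerp A) x
      = -gradient p x) (hJ : jac A ψ x = 0) :
    jac A (bernoulli A ψ p) x = 0 := by
  have e : bernoulli A ψ p = fun y => p y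
      + ((fderiv ℝ ψ y (unitVec 0)) ^ 2 + (fderiv ℝ ψ y (unitVec 1)) ^ 2) * 2⁻¹
      - ((fderiv ℝ A y (unitVec 0)) ^ 2 + (fderiv ℝ A y (unitVec 1)) ^ 2) * 2⁻¹ := by
    funext y
    simp only [bernoulli, norm_gradPerp_sq, div_eq_mul_inv]
  have hb := (hp.differentiableAt.hasFDerivAt.add
    ((((hasFDerivAt_partial hψ (unitVec 0)).pow 2).add
      ((hasFDerivAt_partial hψ (unitVec 1)).pow 2)).mul_const 2⁻¹)).sub
    ((((hasFDerivAt_partial hA (unitVec 0)).pow 2).add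
      ((hasFDerivAt_partial hA (unitVec 1)).pow 2)).mul_const 2⁻¹)
  have hb' := hb.fderiv
  replace hb' : fderiv ℝ (bernoulli A ψ p) x = _ := (congrArg (fun f => fderiv ℝ f x) e).trans hb'
  obtain ⟨a0, a1⟩ := advect_gradPerp_coord (f := ψ) hψ
  obtain ⟨b0, b1⟩ := advect_gradPerp_coord (f := A) hA
  have e0 : advect (gradPerp ψ) (gradPerp ψ) x 0 - advect (gradPerp A) (gradPerp A) x 0
      = -fderiv ℝ p x (unitVec 0) := by
    simpa [gradient_coord] using congrArg (fun w : Plane => w 0) h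
  have e1 : advect (gradPerp ψ) (gradPerp ψ) x 1 - advect (gradPerp A) (gradPerp A) x 1
      = -fderiv ℝ p x (unitVec 1) := by
    simpa [gradient_coord] using congrArg (fun w : Plane => w 1) h
  rw [a0, b0] at e0
  rw [a1, b1] at e1
  have sf := snd_fderiv_symm hψ (unitVec 0) (unitVec 1)
  have sg := snd_fderiv_symm hA (unitVec 0) (unitVec 1)
  unfold jac at hJ ⊢
  rw [hb']
  simp only [sub_apply, add_apply,
    smul_apply, ContinuousLinearMap.comp_apply,
    ContinuousLinearMap.apply_apply, smul_eq_mul]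
  set X := fderiv ℝ (fderiv ℝ ψ) x
  have p0 : fderiv ℝ p x (unitVec 0) = _ := neg_eq_iff_eq_neg.mp e0.symm
  have p1 : fderiv ℝ p x (unitVec 1) = _ := neg_eq_iff_eq_neg.mp e1.symm
  rw [p0, p1]
  simp
  -- With ∇p eliminated, ∇b = Δψ ∇ψ - ΔA ∇A, so the bracket with A is Δψ {A, ψ}.
  linear_combination (X (unitVec 0) (unitVec 0) + X (unitVec 1) (unitVec 1)) * hJ

/-! ### Level sets near a regular point -/

/-- A zero bracket makes df a multiple of da wherever da ≠ 0. In this form the condition can be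
integrated along level curves of a. -/
lemma fderiv_apply_eq_zero_of_jac {a f : Plane → ℝ} {x : Plane} (hx : fderiv ℝ a x ≠ 0)
    (hj : jac a f x = 0) {v : Plane} (hv : fderiv ℝ a x v = 0) : fderiv ℝ f x v = 0 := by
  rw [clm_plane_apply] at hv ⊢
  unfold jac at hj
  simp only [smul_eq_mul] at hv ⊢
  by_cases h0 : fderiv ℝ a x (unitVec 0) = 0
  · have h1 : fderiv ℝ a x (unitVec 1) ≠ 0 := by
      intro h1
      apply hx
      ext w
      rw [clm_plane_apply, h0, h1]
      simp
    apply mul_left_cancel₀ h1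
    linear_combination fderiv ℝ f x (unitVec 1) * hv - v 0 * hj
  · apply mul_left_cancel₀ h0
    linear_combination fderiv ℝ f x (unitVec 0) * hv + v 1 * hj

/-- Straightening of the level sets of `a` near a regular point `x`. -/
lemma exists_regular_chart {a : Plane → ℝ} {x : Plane} (ha : AnalyticAt ℝ a x)
    (hx : fderiv ℝ a x ≠ 0) {V : Set Plane} (hV : V ∈ 𝓝 x) :
    ∃ U ⊆ V, IsOpen U ∧ x ∈ U ∧ ∃ ε > 0,
      (∀ y ∈ U, a y ∈ Ioo (a x - ε) (a x + ε)) ∧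
      (∀ J : Set ℝ, J.OrdConnected → J ⊆ Ioo (a x - ε) (a x + ε) →
        IsPreconnected (U ∩ a ⁻¹' J)) ∧
      (∀ f : Plane → ℝ, ∀ c,
        (∀ y ∈ U, a y = c → DifferentiableAt ℝ f y ∧
          ∀ v, fderiv ℝ a y v = 0 → fderiv ℝ f y v = 0) →
        ∀ y ∈ U, ∀ z ∈ U, a y = c → a z = c → f y = f z) ∧
      ∃ s : ℝ → Plane, DifferentiableAt ℝ s (a x) ∧ s (a x) = x ∧
        ∀ c ∈ Ioo (a x - ε) (a x + ε), s c ∈ U ∧ a (s c) = c := by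
  set α := fderiv ℝ a x (unitVec 0) with hα
  set β := fderiv ℝ a x (unitVec 1) with hβ
  have hαβ : α ^ 2 + β ^ 2 ≠ 0 := by
    intro h
    apply hx
    have h0 : α = 0 := by nlinarith [sq_nonneg α, sq_nonneg β]
    have h1 : β = 0 := by nlinarith [sq_nonneg α, sq_nonneg β]
    ext w
    rw [clm_plane_apply, ← hα, ← hβ, h0, h1]
    simp
  -- ℓ is da rotated by a right angle: (da, ℓ) has determinant α² + β² ≠ 0, so (a, ℓ) is a local
  -- chart by the inverse function theorem.
  let ℓ : Plane →L[ℝ] ℝ := (-β) • (EuclideanSpace.proj 0 : Plane →L[ℝ] ℝ)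
    + α • (EuclideanSpace.proj 1 : Plane →L[ℝ] ℝ)
  let F : Plane → ℝ × ℝ := fun y => (a y, ℓ y)
  let F' : Plane →L[ℝ] ℝ × ℝ := (fderiv ℝ a x).prod ℓ
  have hinj : Function.Injective F' := by
    rw [injective_iff_map_eq_zero]
    intro v hv
    have h1 : fderiv ℝ a x v = 0 := congrArg Prod.fst hv
    have h2 : ℓ v = 0 := congrArg Prod.snd hv
    rw [clm_plane_apply, ← hα, ← hβ] at h1
    simp only [smul_eq_mul] at h1
    have h2' : -β * v 0 + α * v 1 = 0 := by simpa [ℓ] using h2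
    have e0 : v 0 = 0 := by
      apply mul_left_cancel₀ hαβ
      linear_combination α * h1 - β * h2'
    have e1 : v 1 = 0 := by
      apply mul_left_cancel₀ hαβ
      linear_combination β * h1 + α * h2'
    rw [plane_eq_sum v, e0, e1]
    simp
  have hsurj : Function.Surjective F' :=
    (LinearMap.injective_iff_surjective_of_finrank_eq_finrank (f := F'.toLinearMap)
      (by simp)).1 hinj
  let F'' : Plane ≃L[ℝ] ℝ × ℝ := ContinuousLinearEquiv.ofBijective F'
    (LinearMap.ker_eq_bot.2 hinj) (LinearMap.range_eq_top.2 hsurj)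
  have hFc : ContDiffAt ℝ ω F x := ha.contDiffAt.prodMk ℓ.contDiff.contDiffAt
  have hFd : HasFDerivAt F (F'' : Plane →L[ℝ] ℝ × ℝ) x :=
    ha.differentiableAt.hasFDerivAt.prodMk ℓ.hasFDerivAt
  have hn : (ω : WithTop ℕ∞) ≠ 0 := by simp
  let e := hFc.toOpenPartialHomeomorph F hFd hn
  have he : ∀ y, e y = F y := fun y => rfl
  have hxs : x ∈ e.source := hFc.mem_toOpenPartialHomeomorph_source hFd hn
  have hxt : F x ∈ e.target := e.map_source hxs
  have hgx : e.symm (F x) = x := e.left_inv hxs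
  have hgc : ContDiffAt ℝ ω e.symm (F x) := hFc.to_localInverse hFd hn
  have hgd : ∀ᶠ w in 𝓝 (F x), DifferentiableAt ℝ e.symm w := by
    have h1 : ContDiffAt ℝ 1 e.symm (F x) := hgc.of_le le_top
    exact (h1.eventually (by simp)).mono fun w hw => hw.differentiableAt (by simp)
  have hV' : ∀ᶠ w in 𝓝 (F x), e.symm w ∈ V := by
    refine hgc.continuousAt.eventually_mem ?_
    rwa [hgx]
  obtain ⟨ε, hε, hball⟩ := Metric.eventually_nhds_iff_ball.1
    ((hgd.and hV').and (e.open_target.mem_nhds hxt))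
  have hbox : Metric.ball (F x) ε = Ioo (a x - ε) (a x + ε) ×ˢ Ioo (ℓ x - ε) (ℓ x + ε) := by
    rw [← Real.ball_eq_Ioo, ← Real.ball_eq_Ioo, ball_prod_same]
  have hsymm : ∀ w ∈ Metric.ball (F x) ε, e.symm w ∈ e.source ∧ F (e.symm w) = w := fun w hw =>
    ⟨e.map_target (hball w hw).2, e.right_inv (hball w hw).2⟩
  refine ⟨e.source ∩ e ⁻¹' Metric.ball (F x) ε, ?_, e.isOpen_inter_preimage Metric.isOpen_ball,
    ⟨hxs, Metric.mem_ball_self hε⟩, ε, hε, ?_, ?_, ?_, ?_⟩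
  · rintro y ⟨hy, hyb⟩
    have := (hball _ hyb).1.2
    rwa [e.left_inv hy] at this
  · rintro y ⟨hy, hyb⟩
    have : F y ∈ Metric.ball (F x) ε := hyb
    rw [hbox] at this
    exact this.1
  · intro J hJ hJs
    have : (e.source ∩ e ⁻¹' Metric.ball (F x) ε) ∩ a ⁻¹' J
        = e.symm '' (J ×ˢ Ioo (ℓ x - ε) (ℓ x + ε)) := by
      ext y
      constructor
      · rintro ⟨⟨hy, hyb⟩, hyJ⟩
        have hyb' : F y ∈ Metric.ball (F x) ε := hyb
        rw [hbox] at hyb'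
        exact ⟨F y, ⟨hyJ, hyb'.2⟩, e.left_inv hy⟩
      · rintro ⟨w, ⟨hw1, hw2⟩, rfl⟩
        have hwb : w ∈ Metric.ball (F x) ε := by
          rw [hbox]
          exact ⟨hJs hw1, hw2⟩
        obtain ⟨h1, h2⟩ := hsymm w hwb
        refine ⟨⟨h1, ?_⟩, ?_⟩
        · rw [mem_preimage, he, h2]
          exact hwb
        · have : a (e.symm w) = w.1 := congrArg Prod.fst h2
          simpa [this] using hw1
    rw [this]
    refine (hJ.isPreconnected.prod isPreconnected_Ioo).image _ ?_
    refine e.continuousOn_symm.mono ?_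
    rintro w ⟨hw1, hw2⟩
    refine (hball w ?_).2
    rw [hbox]
    exact ⟨hJs hw1, hw2⟩
  · intro f c hf y hy z hz hyc hzc
    have hyb : F y ∈ Metric.ball (F x) ε := hy.2
    have hzb : F z ∈ Metric.ball (F x) ε := hz.2
    rw [hbox] at hyb hzb
    have hcI : c ∈ Ioo (a x - ε) (a x + ε) := hyc ▸ hyb.1
    let h : ℝ → Plane := fun t => e.symm (c, t)
    have hmem : ∀ t ∈ Ioo (ℓ x - ε) (ℓ x + ε), ((c, t) : ℝ × ℝ) ∈ Metric.ball (F x) ε := by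
      intro t ht
      rw [hbox]
      exact ⟨hcI, ht⟩
    have hah : ∀ t ∈ Ioo (ℓ x - ε) (ℓ x + ε), a (h t) = c := fun t ht =>
      congrArg Prod.fst (hsymm _ (hmem t ht)).2
    have hhd : ∀ t ∈ Ioo (ℓ x - ε) (ℓ x + ε), DifferentiableAt ℝ h t := fun t ht =>
      ((hball _ (hmem t ht)).1.1).comp t
        ((differentiableAt_const c).prodMk differentiableAt_id)
    have hhU : ∀ t ∈ Ioo (ℓ x - ε) (ℓ x + ε), h t ∈ e.source ∩ e ⁻¹' Metric.ball (F x) ε := by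
      intro t ht
      obtain ⟨h1, h2⟩ := hsymm _ (hmem t ht)
      refine ⟨h1, ?_⟩
      rw [mem_preimage, he, h2]
      exact hmem t ht
    have hfh : ∀ t ∈ Ioo (ℓ x - ε) (ℓ x + ε), HasDerivAt (f ∘ h) 0 t := by
      intro t ht
      obtain ⟨hfd, hfk⟩ := hf _ (hhU t ht) (hah t ht)
      have hh := (hhd t ht).hasDerivAt
      have hcomp := hfd.hasFDerivAt.comp_hasDerivAt t hh
      -- a is assumed analytic only at x. Where it is not differentiable, `fderiv` is 0 by
      -- convention and the kernel hypothesis on f applies to every vector.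
      by_cases had : DifferentiableAt ℝ a (h t)
      · have h1 := had.hasFDerivAt.comp_hasDerivAt t hh
        have h2 : HasDerivAt (a ∘ h) 0 t := by
          refine (hasDerivAt_const t c).congr_of_eventuallyEq ?_
          filter_upwards [isOpen_Ioo.mem_nhds ht] with s hs using hah s hs
        rwa [hfk _ (h1.unique h2)] at hcomp
      · rwa [hfk _ (by rw [fderiv_zero_of_not_differentiableAt had]; simp)] at hcomp
    have hconst := (isOpen_Ioo (a := ℓ x - ε) (b := ℓ x + ε)).is_const_of_deriv_eq_zero
      isPreconnected_Ioo
      (fun t ht => (hfh t ht).differentiableAt.differentiableWithinAt)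
      (fun t ht => (hfh t ht).deriv) hyb.2 hzb.2
    have ey : h (F y).2 = y := by
      have : e.symm (F y) = y := e.left_inv hy.1
      have h2 : F y = (c, (F y).2) := Prod.ext hyc rfl
      rwa [h2] at this
    have ez : h (F z).2 = z := by
      have : e.symm (F z) = z := e.left_inv hz.1
      have h2 : F z = (c, (F z).2) := Prod.ext hzc rfl
      rwa [h2] at this
    simpa only [Function.comp, ey, ez] using hconst
  -- The transversal through x is the coordinate line on which ℓ is constant; a is its parameter.
  · refine ⟨fun c => e.symm (c, ℓ x), ?_, hgx, ?_⟩
    · exact (hgc.differentiableAt (by simp)).comp (a x)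
        (differentiableAt_id.prodMk (differentiableAt_const (ℓ x)))
    · intro c hc
      have hb : ((c, ℓ x) : ℝ × ℝ) ∈ Metric.ball (F x) ε := by
        rw [hbox]
        exact ⟨hc, by simp [hε]⟩
      obtain ⟨h1, h2⟩ := hsymm _ hb
      refine ⟨⟨h1, ?_⟩, congrArg Prod.fst h2⟩
      rw [mem_preimage, he, h2]
      exact hb

lemma frequently_lt_of_fderiv_ne_zero {a : Plane → ℝ} {x : Plane} (hx : fderiv ℝ a x ≠ 0) :
    ∃ᶠ y in 𝓝 x, a x < a y := by
  intro h
  refine hx (IsLocalMax.fderiv_eq_zero ?_)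
  exact h.mono fun y hy => not_lt.1 hy

/-! ### Flux functions and connectedness of their level sets -/

/-- A flux function: positive in `Ω`, vanishing on `∂Ω`, with a single critical point `x₀`. -/
structure IsFlux (Ω : Set Plane) (a : Plane → ℝ) (x₀ : Plane) : Prop where
  isOpen : IsOpen Ω
  bounded : Bornology.IsBounded Ω
  analytic : AnalyticOnNhd ℝ a (closure Ω)
  zero : ∀ x ∈ frontier Ω, a x = 0
  pos : ∀ x ∈ Ω, 0 < a x
  mem : x₀ ∈ Ω
  regular : ∀ x ∈ closure Ω, x ≠ x₀ → fderiv ℝ a x ≠ 0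

/-- The level sets of `a` in the closure of `Ω`. -/
def levelSet (Ω : Set Plane) (a : Plane → ℝ) (c : ℝ) : Set Plane := closure Ω ∩ a ⁻¹' {c}

namespace IsFlux

variable {Ω : Set Plane} {a : Plane → ℝ} {x₀ : Plane}

lemma isCompact_closure (h : IsFlux Ω a x₀) : IsCompact (closure Ω) :=
  h.bounded.isCompact_closure

lemma continuousOn (h : IsFlux Ω a x₀) : ContinuousOn a (closure Ω) := h.analytic.continuousOn

lemma isCompact_levelSet (h : IsFlux Ω a x₀) (c : ℝ) : IsCompact (levelSet Ω a c) :=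
  h.isCompact_closure.of_isClosed_subset
    (h.continuousOn.preimage_isClosed_of_isClosed isClosed_closure isClosed_singleton)
    inter_subset_left

lemma mem_or_mem_frontier (h : IsFlux Ω a x₀) {x : Plane} (hx : x ∈ closure Ω) :
    x ∈ Ω ∨ x ∈ frontier Ω := by
  by_cases hxΩ : x ∈ Ω
  · exact Or.inl hxΩ
  · exact Or.inr ⟨hx, by rwa [h.isOpen.interior_eq]⟩

lemma notMem_of_mem_frontier (h : IsFlux Ω a x₀) {x : Plane} (hx : x ∈ frontier Ω) : x ∉ Ω := by
  have := hx.2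
  rwa [h.isOpen.interior_eq] at this

lemma nonneg (h : IsFlux Ω a x₀) {x : Plane} (hx : x ∈ closure Ω) : 0 ≤ a x := by
  rcases h.mem_or_mem_frontier hx with hx | hx
  · exact (h.pos x hx).le
  · exact (h.zero x hx).ge

lemma ne_of_mem_frontier (h : IsFlux Ω a x₀) {x : Plane} (hx : x ∈ frontier Ω) : x ≠ x₀ := by
  rintro rfl
  exact h.notMem_of_mem_frontier hx h.mem

lemma regular_frontier (h : IsFlux Ω a x₀) {x : Plane} (hx : x ∈ frontier Ω) :
    fderiv ℝ a x ≠ 0 :=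
  h.regular x (frontier_subset_closure hx) (h.ne_of_mem_frontier hx)

/-- Since a(x₀) > 0 and a = 0 on the frontier, a maximum point is interior, hence critical. -/
lemma eq_of_isMaxOn (h : IsFlux Ω a x₀) {x : Plane} (hx : x ∈ closure Ω)
    (hm : IsMaxOn a (closure Ω) x) : x = x₀ := by
  have h0 : a x₀ ≤ a x := hm (subset_closure h.mem)
  have hxΩ : x ∈ Ω := by
    rcases h.mem_or_mem_frontier hx with hx | hx
    · exact hx
    · have := h.pos x₀ h.mem
      have := h.zero x hx
      linarith
  by_contra hne
  refine h.regular x hx hne (IsLocalMax.fderiv_eq_zero ?_)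
  filter_upwards [h.isOpen.mem_nhds hxΩ] with y hy using hm (subset_closure hy)

lemma isMaxOn (h : IsFlux Ω a x₀) : IsMaxOn a (closure Ω) x₀ := by
  obtain ⟨x, hx, hm⟩ := h.isCompact_closure.exists_isMaxOn ⟨x₀, subset_closure h.mem⟩
    h.continuousOn
  rwa [h.eq_of_isMaxOn hx hm] at hm

lemma eq_of_eq_max (h : IsFlux Ω a x₀) {x : Plane} (hx : x ∈ closure Ω) (he : a x = a x₀) :
    x = x₀ :=
  h.eq_of_isMaxOn hx fun _ hy => he ▸ h.isMaxOn hy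

/-- Near a boundary point, `Ω` is the side `{a > 0}` of the curve `{a = 0}`. -/
lemma eventually_mem_iff (h : IsFlux Ω a x₀) {x : Plane} (hx : x ∈ frontier Ω) :
    ∀ᶠ y in 𝓝 x, (y ∈ Ω ↔ 0 < a y) ∧ (y ∈ closure Ω ↔ 0 ≤ a y) := by
  have hxc := frontier_subset_closure hx
  have hreg := h.regular_frontier hx
  have han := h.analytic x hxc
  have hreg' : ∀ᶠ y in 𝓝 x, fderiv ℝ a y ≠ 0 :=
    han.fderiv.continuousAt.eventually_ne hreg
  obtain ⟨U, hUV, hUo, hxU, ε, hε, hUI, hconn, -, -⟩ := exists_regular_chart han hreg hreg'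
  have hax := h.zero x hx
  rw [hax] at hUI hconn
  -- This piece of the chart is connected and misses the frontier, where a = 0. It meets Ω because x
  -- is in the closure, so it cannot also meet the exterior.
  have hsub : U ∩ a ⁻¹' (Ioo 0 ε) ⊆ Ω := by
    have hpre := hconn (Ioo 0 ε) ordConnected_Ioo (Ioo_subset_Ioo (by linarith) (by linarith))
    by_contra hnot
    obtain ⟨y, hy, hyΩ⟩ := not_subset.1 hnot
    obtain ⟨w, hwU, hwΩ⟩ := mem_closure_iff.1 hxc U hUo hxU
    have hw : w ∈ U ∩ a ⁻¹' (Ioo 0 ε) := by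
      refine ⟨hwU, h.pos w hwΩ, ?_⟩
      have := (hUI w hwU).2
      linarith
    have hout : ∀ z ∈ U ∩ a ⁻¹' (Ioo 0 ε), z ∉ Ω → z ∈ (closure Ω)ᶜ := fun z hz hzΩ hzc =>
      hz.2.1.ne' (h.zero z ((h.mem_or_mem_frontier hzc).resolve_left hzΩ))
    obtain ⟨z, -, hz1, hz2⟩ := hpre Ω (closure Ω)ᶜ h.isOpen isClosed_closure.isOpen_compl
      (fun z hz => (em (z ∈ Ω)).imp_right (hout z hz)) ⟨w, hw, hwΩ⟩ ⟨y, hy, hout y hy hyΩ⟩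
    exact hz2 (subset_closure hz1)
  have hpos : ∀ y ∈ U, 0 < a y → y ∈ Ω := fun y hy hy0 =>
    hsub ⟨hy, hy0, by have := (hUI y hy).2; linarith⟩
  filter_upwards [hUo.mem_nhds hxU] with y hy
  refine ⟨⟨h.pos y, hpos y hy⟩, h.nonneg, fun hy0 => ?_⟩
  rcases hy0.lt_or_eq with hlt | heq
  · exact subset_closure (hpos y hy hlt)
  -- A regular zero of a is not a local maximum, so points with a > 0, which lie in Ω, accumulate at
  -- it.
  · rw [mem_closure_iff_frequently]
    refine ((frequently_lt_of_fderiv_ne_zero (hUV hy)).and_eventually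
      (hUo.mem_nhds hy)).mono ?_
    rintro z ⟨hz, hzU⟩
    exact hpos z hzU (heq ▸ hz)

/-- Straightening of the level sets in the closure of `Ω`, at all points but the critical one. -/
lemma exists_chart (h : IsFlux Ω a x₀) {x : Plane} (hx : x ∈ closure Ω) (hx0 : x ≠ x₀)
    {V : Set Plane} (hV : V ∈ 𝓝 x) :
    ∃ U ⊆ V, IsOpen U ∧ x ∈ U ∧ ∃ ε > 0,
      (∀ c ∈ Ioo (a x - ε) (a x + ε), 0 ≤ c → IsPreconnected (U ∩ levelSet Ω a c) ∧
        (U ∩ levelSet Ω a c).Nonempty) ∧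
      (∀ f : Plane → ℝ, ∀ c, AnalyticOnNhd ℝ f (closure Ω) →
        (∀ y ∈ closure Ω, jac a f y = 0) →
        ∀ y ∈ U ∩ levelSet Ω a c, ∀ z ∈ U ∩ levelSet Ω a c, f y = f z) ∧
      ∃ s : ℝ → Plane, DifferentiableAt ℝ s (a x) ∧
        s (a x) = x ∧ ∀ c ∈ Ioo (a x - ε) (a x + ε), 0 ≤ c → s c ∈ levelSet Ω a c := by
  -- On such a neighbourhood, levels c ≥ 0 of a lie automatically in the closure of Ω, so the chart
  -- of the plane also serves at boundary points.
  have hV' : ∀ᶠ y in 𝓝 x, y ∈ V ∧ fderiv ℝ a y ≠ 0 ∧ (0 ≤ a y → y ∈ closure Ω) := by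
    refine Filter.Eventually.and hV ?_
    refine ((h.analytic x hx).fderiv.continuousAt.eventually_ne (h.regular x hx hx0)).and ?_
    rcases h.mem_or_mem_frontier hx with hx | hx
    · filter_upwards [h.isOpen.mem_nhds hx] with y hy _ using subset_closure hy
    · filter_upwards [h.eventually_mem_iff hx] with y hy using hy.2.2
  obtain ⟨U, hUV, hUo, hxU, ε, hε, -, hconn, hf, s, hs, hsx, hsU⟩ :=
    exists_regular_chart (h.analytic x hx) (h.regular x hx hx0) hV'
  have hlev : ∀ c, 0 ≤ c → U ∩ levelSet Ω a c = U ∩ a ⁻¹' {c} := by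
    intro c hc
    ext y
    constructor
    · rintro ⟨h1, h2⟩
      exact ⟨h1, h2.2⟩
    · rintro ⟨h1, h2⟩
      refine ⟨h1, (hUV h1).2.2 ?_, h2⟩
      have : a y = c := h2
      rwa [this]
  have hsL : ∀ c ∈ Ioo (a x - ε) (a x + ε), 0 ≤ c → s c ∈ levelSet Ω a c := by
    intro c hc hc0
    have : s c ∈ U ∩ levelSet Ω a c := by
      rw [hlev c hc0]
      exact hsU c hc
    exact this.2
  refine ⟨U, fun y hy => (hUV hy).1, hUo, hxU, ε, hε, fun c hc hc0 => ⟨?_, ?_⟩, ?_, s, hs, hsx,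
    hsL⟩
  · rw [hlev c hc0]
    exact hconn {c} ordConnected_singleton (singleton_subset_iff.2 hc)
  · exact ⟨s c, (hsU c hc).1, hsL c hc hc0⟩
  · intro f c hfan hj y hy z hz
    have hc0 : 0 ≤ c := by
      have h1 : a y = c := hy.2.2
      rw [← h1]
      exact h.nonneg hy.2.1
    refine hf f c (fun w hw hwc => ?_) y hy.1 z hz.1 hy.2.2 hz.2.2
    have hwcl : w ∈ closure Ω := (hUV hw).2.2 (hwc ▸ hc0)
    exact ⟨(hfan w hwcl).differentiableAt, fun v hv =>
      fderiv_apply_eq_zero_of_jac (hUV hw).2.1 (hj w hwcl) hv⟩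

lemma ne_of_mem_levelSet {c : ℝ} (hc : c < a x₀) {x : Plane}
    (hx : x ∈ levelSet Ω a c) : x ≠ x₀ := by
  rintro rfl
  exact hc.ne hx.2.symm

/-- Upper semicontinuity in c: the values of a on the compact set closure Ω \ W form a closed set
that misses c. -/
lemma eventually_levelSet_subset (h : IsFlux Ω a x₀) {c : ℝ} {W : Set Plane} (hW : IsOpen W)
    (hc : levelSet Ω a c ⊆ W) : ∀ᶠ c' in 𝓝 c, levelSet Ω a c' ⊆ W := by
  have hcomp : IsCompact (a '' (closure Ω \ W)) :=
    (h.isCompact_closure.diff hW).image_of_continuousOn (h.continuousOn.mono sdiff_subset)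
  have hcn : c ∉ a '' (closure Ω \ W) := by
    rintro ⟨y, ⟨hy, hyW⟩, rfl⟩
    exact hyW (hc ⟨hy, rfl⟩)
  filter_upwards [hcomp.isClosed.isOpen_compl.mem_nhds hcn] with c' hc' y hy
  by_contra hyW
  exact hc' ⟨y, ⟨hy.1, hyW⟩, hy.2⟩

/-- Lower semicontinuity in c: a chart at a regular point of level c meets every nearby nonnegative
level. -/
lemma eventually_levelSet_inter (h : IsFlux Ω a x₀) {c : ℝ} (hc : c < a x₀) {W : Set Plane}
    (hW : IsOpen W) (hne : (W ∩ levelSet Ω a c).Nonempty) :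
    ∀ᶠ c' in 𝓝 c, 0 ≤ c' → (W ∩ levelSet Ω a c').Nonempty := by
  obtain ⟨x, hxW, hxL⟩ := hne
  obtain ⟨U, hUW, -, -, ε, hε, hL, -, -⟩ :=
    h.exists_chart hxL.1 (ne_of_mem_levelSet hc hxL) (hW.mem_nhds hxW)
  have hax : a x = c := hxL.2
  rw [hax] at hL
  filter_upwards [Ioo_mem_nhds (by linarith : c - ε < c) (by linarith : c < c + ε)] with c' hc' h0
  exact (hL c' hc' h0).2.mono (inter_subset_inter_left _ hUW)

/-- Connectedness is open in c. Finitely many charts cover level c and also nearby levels; each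
chart meets a nearby level in a connected piece, and overlaps present on level c persist. A
separation of the nearby level would sort the charts into two families, and these would separate
level c. -/
lemma eventually_isPreconnected (h : IsFlux Ω a x₀) {c : ℝ} (hc : c < a x₀)
    (hconn : IsPreconnected (levelSet Ω a c)) :
    ∀ᶠ c' in 𝓝 c, 0 ≤ c' → IsPreconnected (levelSet Ω a c') := by
  have key : ∀ x : levelSet Ω a c, ∃ U : Set Plane, IsOpen U ∧ (x : Plane) ∈ U ∧ ∃ ε > 0,
      ∀ c' ∈ Ioo (c - ε) (c + ε), 0 ≤ c' → IsPreconnected (U ∩ levelSet Ω a c') := by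
    rintro ⟨x, hx⟩
    obtain ⟨U, -, hUo, hxU, ε, hε, hL, -, -⟩ :=
      h.exists_chart hx.1 (ne_of_mem_levelSet hc hx) univ_mem
    have hax : a x = c := hx.2
    rw [hax] at hL
    exact ⟨U, hUo, hxU, ε, hε, fun c' hc' h0 => (hL c' hc' h0).1⟩
  choose U hUo hxU ε hε hL using key
  obtain ⟨t, ht⟩ := (h.isCompact_levelSet c).elim_finite_subcover U hUo
    (fun x hx => mem_iUnion.2 ⟨⟨x, hx⟩, hxU ⟨x, hx⟩⟩)
  have e1 := h.eventually_levelSet_subset (isOpen_biUnion fun i (_ : i ∈ t) => hUo i) ht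
  have e2 : ∀ᶠ c' in 𝓝 c, ∀ i ∈ t, c' ∈ Ioo (c - ε i) (c + ε i) := by
    rw [Filter.eventually_all_finset]
    exact fun i _ => Ioo_mem_nhds (by linarith [hε i]) (by linarith [hε i])
  have e3 : ∀ᶠ c' in 𝓝 c, ∀ i ∈ t, ∀ j ∈ t, ((U i ∩ U j) ∩ levelSet Ω a c).Nonempty → 0 ≤ c' →
      ((U i ∩ U j) ∩ levelSet Ω a c').Nonempty := by
    rw [Filter.eventually_all_finset]
    intro i _
    rw [Filter.eventually_all_finset]
    intro j _
    by_cases hne : ((U i ∩ U j) ∩ levelSet Ω a c).Nonempty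
    · filter_upwards [h.eventually_levelSet_inter hc ((hUo i).inter (hUo j)) hne] with c' hc' _
        using hc'
    · exact Eventually.of_forall fun c' hh => absurd hh hne
  filter_upwards [e1, e2, e3] with c' h1 h2 h3 h0
  rw [isPreconnected_iff_subset_of_disjoint]
  intro u v hu hv huv hdis
  have piece : ∀ i ∈ t, U i ∩ levelSet Ω a c' ⊆ u ∨ U i ∩ levelSet Ω a c' ⊆ v := by
    intro i hi
    refine isPreconnected_iff_subset_of_disjoint.1 (hL i c' (h2 i hi) h0) u v hu hv
      (inter_subset_right.trans huv) ?_
    refine subset_empty_iff.1 (hdis ▸ ?_)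
    exact inter_subset_inter_left _ inter_subset_right
  have noboth : ∀ i ∈ t, ∀ j ∈ t, ((U i ∩ U j) ∩ levelSet Ω a c).Nonempty →
      U i ∩ levelSet Ω a c' ⊆ u → U j ∩ levelSet Ω a c' ⊆ v → False := by
    intro i hi j hj hne hiu hjv
    obtain ⟨z, ⟨hzi, hzj⟩, hz⟩ := h3 i hi j hj hne h0
    have : z ∈ levelSet Ω a c' ∩ (u ∩ v) := ⟨hz, hiu ⟨hzi, hz⟩, hjv ⟨hzj, hz⟩⟩
    rw [hdis] at this
    exact this
  have split := isPreconnected_iff_subset_of_disjoint.1 hconn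
    (⋃ i ∈ {i | i ∈ t ∧ U i ∩ levelSet Ω a c' ⊆ u}, U i)
    (⋃ i ∈ {i | i ∈ t ∧ U i ∩ levelSet Ω a c' ⊆ v}, U i)
    (isOpen_biUnion fun i _ => hUo i) (isOpen_biUnion fun i _ => hUo i)
    (by
      intro x hx
      obtain ⟨i, hi, hxi⟩ := mem_iUnion₂.1 (ht hx)
      rcases piece i hi with hp | hp
      · exact Or.inl (mem_iUnion₂.2 ⟨i, ⟨hi, hp⟩, hxi⟩)
      · exact Or.inr (mem_iUnion₂.2 ⟨i, ⟨hi, hp⟩, hxi⟩))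
    (by
      rw [eq_empty_iff_forall_notMem]
      rintro x ⟨hx, hx1, hx2⟩
      obtain ⟨i, hi, hxi⟩ := mem_iUnion₂.1 hx1
      obtain ⟨j, hj, hxj⟩ := mem_iUnion₂.1 hx2
      exact noboth i hi.1 j hj.1 ⟨x, ⟨hxi, hxj⟩, hx⟩ hi.2 hj.2)
  rcases split with hs | hs
  · left
    intro y hy
    obtain ⟨i, hi, hyi⟩ := mem_iUnion₂.1 (h1 hy)
    rcases piece i hi with hp | hp
    · exact hp ⟨hyi, hy⟩
    · obtain ⟨j, hj, hij⟩ := mem_iUnion₂.1 (hs i.2)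
      exact (noboth j hj.1 i hi ⟨i, ⟨hij, hxU i⟩, i.2⟩ hj.2 hp).elim
  · right
    intro y hy
    obtain ⟨i, hi, hyi⟩ := mem_iUnion₂.1 (h1 hy)
    rcases piece i hi with hp | hp
    · obtain ⟨j, hj, hij⟩ := mem_iUnion₂.1 (hs i.2)
      exact (noboth i hi j hj.1 ⟨i, ⟨hxU i, hij⟩, i.2⟩ hp hj.2).elim
    · exact hp ⟨hyi, hy⟩

/-- Connectedness is closed in c: disjoint open sets separating level c would, by the two
semicontinuities, separate all nearby nonnegative levels. -/
lemma isPreconnected_of_frequently (h : IsFlux Ω a x₀) {c : ℝ} (hc : c < a x₀)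
    (hfreq : ∃ᶠ c' in 𝓝 c, 0 ≤ c' ∧ IsPreconnected (levelSet Ω a c')) :
    IsPreconnected (levelSet Ω a c) := by
  rw [isPreconnected_iff_subset_of_fully_disjoint_closed (h.isCompact_levelSet c).isClosed]
  intro u v hu hv huv hdis
  by_contra hcon
  push Not at hcon
  obtain ⟨hnu, hnv⟩ := hcon
  obtain ⟨x, hx, hxu⟩ := not_subset.1 hnu
  obtain ⟨y, hy, hyv⟩ := not_subset.1 hnv
  have hxv : x ∈ v := (huv hx).resolve_left hxu
  have hyu : y ∈ u := (huv hy).resolve_right hyv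
  obtain ⟨u', v', hu', hv', huu, hvv, hd⟩ := normal_separation hu hv hdis
  have e1 := h.eventually_levelSet_subset (hu'.union hv')
    (huv.trans (union_subset_union huu hvv))
  have e2 := h.eventually_levelSet_inter hc hu' ⟨y, huu hyu, hy⟩
  have e3 := h.eventually_levelSet_inter hc hv' ⟨x, hvv hxv, hx⟩
  obtain ⟨c', ⟨hc0, hpre⟩, h1, h2, h3⟩ := (hfreq.and_eventually (e1.and (e2.and e3))).exists
  obtain ⟨z, hz, hzu, hzv⟩ := hpre u' v' hu' hv' h1
    (by rw [inter_comm]; exact h2 hc0) (by rw [inter_comm]; exact h3 hc0)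
  exact disjoint_left.1 hd hzu hzv

lemma levelSet_zero (h : IsFlux Ω a x₀) : levelSet Ω a 0 = frontier Ω := by
  ext x
  constructor
  · rintro ⟨hx, hx0⟩
    rcases h.mem_or_mem_frontier hx with hx | hx
    · exact absurd hx0 (h.pos x hx).ne'
    · exact hx
  · exact fun hx => ⟨frontier_subset_closure hx, h.zero x hx⟩

/-- All level sets of a flux function are connected, if the boundary is. -/
theorem isPreconnected_levelSet (h : IsFlux Ω a x₀) (hfr : IsPreconnected (frontier Ω)) (c : ℝ) :
    IsPreconnected (levelSet Ω a c) := by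
  rcases lt_or_ge c 0 with hc0 | hc0
  · have : levelSet Ω a c = ∅ := by
      rw [eq_empty_iff_forall_notMem]
      rintro x ⟨hx, hxc⟩
      have := h.nonneg hx
      have hxc' : a x = c := hxc
      linarith
    rw [this]
    exact isPreconnected_empty
  rcases lt_or_ge c (a x₀) with hc | hc
  -- Continuous induction on the level, starting from the boundary level 0; c < a x₀ keeps every
  -- level away from the critical point.
  · have hsub : Icc 0 c ⊆ {c' | IsPreconnected (levelSet Ω a c')} := by
      refine IsClosed.Icc_subset_of_forall_exists_gt ?_ ?_ ?_
      · refine isClosed_of_closure_subset fun c' hc' => ?_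
        have hI : c' ∈ Icc 0 c := closure_minimal inter_subset_right isClosed_Icc hc'
        refine ⟨h.isPreconnected_of_frequently (hI.2.trans_lt hc) ?_, hI⟩
        exact (mem_closure_iff_frequently.1 hc').mono fun d hd => ⟨hd.2.1, hd.1⟩
      · change IsPreconnected _
        rwa [h.levelSet_zero]
      · rintro d ⟨hd, hd0, hdc⟩ y hy
        have e := h.eventually_isPreconnected (hdc.trans hc) hd
        have e' : ∀ᶠ d' in 𝓝[>] d, d' ∈ Ioc d y := Ioc_mem_nhdsGT hy
        obtain ⟨d', h1, h2⟩ := ((e.filter_mono nhdsWithin_le_nhds).and e').exists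
        exact ⟨d', h1 (hd0.trans h2.1.le), h2⟩
    exact hsub ⟨hc0, le_rfl⟩
  · refine Set.Subsingleton.isPreconnected fun x hx y hy => ?_
    have : ∀ z ∈ levelSet Ω a c, z = x₀ := fun z hz => by
      refine h.eq_of_eq_max hz.1 (le_antisymm (h.isMaxOn hz.1) ?_)
      have : a z = c := hz.2
      rwa [this]
    rw [this x hx, this y hy]

/-- A function whose gradient is parallel to that of a flux function `a` is a function of `a`. -/
theorem eq_of_flux_eq (h : IsFlux Ω a x₀) (hfr : IsPreconnected (frontier Ω)) {f : Plane → ℝ}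
    (hf : AnalyticOnNhd ℝ f (closure Ω)) (hj : ∀ y ∈ closure Ω, jac a f y = 0)
    {x y : Plane} (hx : x ∈ closure Ω) (hy : y ∈ closure Ω) (hxy : a x = a y) : f x = f y := by
  by_cases hm : a x = a x₀
  · rw [h.eq_of_eq_max hx hm, h.eq_of_eq_max hy (hxy ▸ hm)]
  · refine (h.isPreconnected_levelSet hfr (a x)).induction₂ (fun x y => f x = f y) ?_
      (fun _ _ _ _ _ _ h1 h2 => h1.trans h2) (fun _ _ _ _ h1 => h1.symm) ⟨hx, rfl⟩ ⟨hy, hxy.symm⟩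
    intro z hz
    have hz0 : z ≠ x₀ := by
      rintro rfl
      exact hm hz.2.symm
    obtain ⟨U, -, hUo, hzU, ε, -, -, hc, -⟩ := h.exists_chart hz.1 hz0 univ_mem
    filter_upwards [self_mem_nhdsWithin, nhdsWithin_le_nhds (hUo.mem_nhds hzU)] with w hw hwU
    exact hc f (a x) hf hj z ⟨hzU, hz⟩ w ⟨hwU, hw⟩

end IsFlux

/-! ### From the solution to its profiles -/

/-- The positive maximum is interior, so it is attained at the only critical point. A negative
value, or a zero inside Ω, would give an interior minimum: a critical point with a different value
of A. -/
lemma isFlux_of_pos {Ω : Set Plane} (hΩ : IsAnalyticDomain Ω) {A : Plane → ℝ}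
    (hA : AnalyticOnNhd ℝ A (closure Ω)) (hA0 : ∀ x ∈ frontier Ω, A x = 0)
    (hnull : ∃! x, x ∈ closure Ω ∧ fderiv ℝ A x = 0) (hpos : ∃ x ∈ closure Ω, 0 < A x) :
    ∃ x₀, IsFlux Ω A x₀ := by
  obtain ⟨x₀, ⟨hx₀, hcrit⟩, huniq⟩ := hnull
  have hK : IsCompact (closure Ω) := hΩ.bounded.isCompact_closure
  have hmem : ∀ x ∈ closure Ω, A x ≠ 0 → x ∈ Ω := by
    intro x hx hne
    by_contra hxΩ
    exact hne (hA0 x ⟨hx, by rwa [hΩ.isOpen.interior_eq]⟩)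
  obtain ⟨xM, hxM, hM⟩ := hK.exists_isMaxOn ⟨x₀, hx₀⟩ hA.continuousOn
  obtain ⟨xm, hxm, hm⟩ := hK.exists_isMinOn ⟨x₀, hx₀⟩ hA.continuousOn
  obtain ⟨y, hy, hy0⟩ := hpos
  have hMpos : 0 < A xM := hy0.trans_le (hM hy)
  have hmin : ∀ z ∈ Ω, IsMinOn A (closure Ω) z → z = x₀ := by
    intro z hz hzm
    refine huniq z ⟨subset_closure hz, IsLocalMin.fderiv_eq_zero ?_⟩
    filter_upwards [hΩ.isOpen.mem_nhds hz] with w hw using hzm (subset_closure hw)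
  have hMΩ : xM ∈ Ω := hmem xM hxM hMpos.ne'
  have hMeq : xM = x₀ := by
    refine huniq xM ⟨hxM, IsLocalMax.fderiv_eq_zero ?_⟩
    filter_upwards [hΩ.isOpen.mem_nhds hMΩ] with w hw using hM (subset_closure hw)
  have hge : 0 ≤ A xm := by
    by_contra hlt
    push Not at hlt
    have := hmin xm (hmem xm hxm hlt.ne) hm
    rw [← hMeq] at this
    rw [this] at hlt
    linarith
  refine ⟨x₀, hΩ.isOpen, hΩ.bounded, hA, hA0, fun x hx => ?_, hMeq ▸ hMΩ,
    fun x hx hne h0 => hne (huniq x ⟨hx, h0⟩)⟩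
  have h0 : 0 ≤ A x := hge.trans (hm (subset_closure hx))
  refine h0.lt_of_ne' fun hx0 => ?_
  have : x = x₀ := hmin x hx fun z hz => by
    change A x ≤ A z
    rw [hx0]
    exact hge.trans (hm hz)
  rw [this, ← hMeq] at hx0
  exact hMpos.ne' hx0

/-- Up to a sign, a normalized potential with one critical point is a flux function. -/
lemma exists_isFlux {Ω : Set Plane} (hΩ : IsAnalyticDomain Ω) {A : Plane → ℝ}
    (hA : AnalyticOnNhd ℝ A (closure Ω)) (hA0 : ∀ x ∈ frontier Ω, A x = 0)
    (hnull : ∃! x, x ∈ closure Ω ∧ gradPerp A x = 0) :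
    ∃ x₀, IsFlux Ω A x₀ ∨ IsFlux Ω (fun x => -A x) x₀ := by
  simp only [gradPerp_eq_zero_iff] at hnull
  by_cases hpos : ∃ x ∈ closure Ω, 0 < A x
  · obtain ⟨x₀, h⟩ := isFlux_of_pos hΩ hA hA0 hnull hpos
    exact ⟨x₀, Or.inl h⟩
  by_cases hneg : ∃ x ∈ closure Ω, 0 < -A x
  · have hnull' : ∃! x, x ∈ closure Ω ∧ fderiv ℝ (fun x => -A x) x = 0 := by
      simpa [fderiv_fun_neg] using hnull
    obtain ⟨x₀, h⟩ := isFlux_of_pos hΩ hA.neg (fun x hx => by simp [hA0 x hx]) hnull' hneg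
    exact ⟨x₀, Or.inr h⟩
  -- Now A = 0 throughout the closure, so every point of Ω is critical and Ω is a singleton, which
  -- is not open.
  exfalso
  push Not at hpos hneg
  obtain ⟨x₀, ⟨hx₀, -⟩, huniq⟩ := hnull
  have hall : ∀ x ∈ Ω, x = x₀ := by
    intro x hx
    refine huniq x ⟨subset_closure hx, ?_⟩
    have : A =ᶠ[𝓝 x] fun _ => 0 := by
      filter_upwards [hΩ.isOpen.mem_nhds hx] with y hy
      have h1 := hpos y (subset_closure hy)
      have h2 := hneg y (subset_closure hy)
      linarith
    rw [this.fderiv_eq]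
    simp
  have hne : Ω.Nonempty := closure_nonempty_iff.1 ⟨x₀, hx₀⟩
  have hsing : Ω = {x₀} := by
    obtain ⟨y, hy⟩ := hne
    refine Subset.antisymm (fun x hx => hall x hx) ?_
    rw [singleton_subset_iff, ← hall y hy]
    exact hy
  exact not_isOpen_singleton x₀ (hsing ▸ hΩ.isOpen)

lemma IsAnalyticDomain.isPreconnected_frontier {Ω : Set Plane} (hΩ : IsAnalyticDomain Ω) :
    IsPreconnected (frontier Ω) := by
  obtain ⟨γ, hγ, hr⟩ := hΩ.boundary
  rw [← hr]
  exact isPreconnected_range hγ.contDiff.continuous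

lemma IsAnalyticDomain.frontier_nonempty {Ω : Set Plane} (hΩ : IsAnalyticDomain Ω) :
    (frontier Ω).Nonempty := by
  obtain ⟨γ, -, hr⟩ := hΩ.boundary
  rw [← hr]
  exact range_nonempty γ

lemma IsAnalyticDomain.isPreconnected {Ω : Set Plane} (hΩ : IsAnalyticDomain Ω) :
    IsPreconnected Ω := by
  have := hΩ.simplyConnected.simplyConnectedSpace
  exact isPreconnected_iff_preconnectedSpace.2 inferInstance

lemma jac_neg (f g : Plane → ℝ) (x : Plane) : jac (fun y => -f y) g x = -jac f g x := by
  simp only [jac, fderiv_fun_neg, neg_apply]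
  ring

/-- If the gradient of `f` is parallel to that of a flux function `a`, then `f` is a function
of `a`, differentiable at the boundary value of `a`. -/
lemma IsFlux.exists_profile {Ω : Set Plane} {a : Plane → ℝ} {x₀ : Plane} (h : IsFlux Ω a x₀)
    (hfr : IsPreconnected (frontier Ω)) (hne : (frontier Ω).Nonempty) {f : Plane → ℝ}
    (hf : AnalyticOnNhd ℝ f (closure Ω)) (hj : ∀ y ∈ closure Ω, jac a f y = 0) :
    ∃ G : ℝ → ℝ, DifferentiableAt ℝ G 0 ∧ ∀ x ∈ closure Ω, f x = G (a x) := by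
  classical
  obtain ⟨y, hy⟩ := hne
  have hyc := frontier_subset_closure hy
  obtain ⟨-, -, -, -, ε, hε, -, -, s, hs, hsy, hsL⟩ :=
    h.exists_chart hyc (h.ne_of_mem_frontier hy) univ_mem
  rw [h.zero y hy] at hs hsy hsL
  -- Negative levels are empty, so the default value f (s c) makes G = f ∘ s on both sides of 0.
  -- This gives two-sided differentiability.
  let G : ℝ → ℝ := fun c => if hc : (levelSet Ω a c).Nonempty then f hc.some else f (s c)
  have hG : ∀ x ∈ closure Ω, f x = G (a x) := by
    intro x hx
    have hc : (levelSet Ω a (a x)).Nonempty := ⟨x, hx, rfl⟩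
    simp only [G, dif_pos hc]
    exact h.eq_of_flux_eq hfr hf hj hx hc.some_mem.1 hc.some_mem.2.symm
  refine ⟨G, ?_, hG⟩
  have hGs : G =ᶠ[𝓝 0] fun c => f (s c) := by
    filter_upwards [Ioo_mem_nhds (by linarith : 0 - ε < 0) (by linarith : 0 < 0 + ε)] with c hc
    rcases le_or_gt 0 c with h0 | h0
    · have hsc := hsL c hc h0
      rw [hG _ hsc.1, hsc.2]
    · have : ¬ (levelSet Ω a c).Nonempty := by
        rintro ⟨z, hz, hzc⟩
        have := h.nonneg hz
        have hzc' : a z = c := hzc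
        linarith
      simp only [G, dif_neg this]
  refine hGs.differentiableAt_iff.2 ?_
  refine DifferentiableAt.comp (0 : ℝ) (g := f) ?_ hs
  rw [hsy]
  exact (hf y hyc).differentiableAt

lemma exists_profile_of_jac {Ω : Set Plane} (hΩ : IsAnalyticDomain Ω) {A : Plane → ℝ} {x₀ : Plane}
    (h : IsFlux Ω A x₀ ∨ IsFlux Ω (fun x => -A x) x₀) {f : Plane → ℝ}
    (hf : AnalyticOnNhd ℝ f (closure Ω)) (hj : ∀ y ∈ closure Ω, jac A f y = 0) :
    ∃ G : ℝ → ℝ, DifferentiableAt ℝ G 0 ∧ ∀ x ∈ closure Ω, f x = G (A x) := by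
  rcases h with h | h
  · exact h.exists_profile hΩ.isPreconnected_frontier hΩ.frontier_nonempty hf hj
  · obtain ⟨G, hG, hGf⟩ := h.exists_profile hΩ.isPreconnected_frontier hΩ.frontier_nonempty hf
      (fun y hy => by rw [jac_neg, hj y hy, neg_zero])
    refine ⟨fun c => G (-c), ?_, hGf⟩
    refine DifferentiableAt.comp (0 : ℝ) (g := G) ?_ differentiableAt_id.neg
    simpa using hG

theorem exists_isProfile {Ω : Set Plane} (hΩ : IsAnalyticDomain Ω) {A ψ p : Plane → ℝ}
    (hA : AnalyticOnNhd ℝ A (closure Ω)) (hψ : AnalyticOnNhd ℝ ψ (closure Ω))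
    (hp : AnalyticOnNhd ℝ p (closure Ω)) (hsol : IsSteadyMHD Ω (gradPerp ψ) (gradPerp A) p)
    {x₀ : Plane} (h : IsFlux Ω A x₀ ∨ IsFlux Ω (fun x => -A x) x₀)
    (hx₀ : fderiv ℝ A x₀ = 0) : ∃ G H : ℝ → ℝ, IsProfile Ω A ψ p G H := by
  have hmem : x₀ ∈ Ω := h.elim (fun h => h.mem) (fun h => h.mem)
  -- The equations hold only in Ω; brackets are continuous up to the boundary.
  have extend : ∀ f : Plane → ℝ, AnalyticOnNhd ℝ f (closure Ω) → (∀ x ∈ Ω, jac A f x = 0) →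
      ∀ x ∈ closure Ω, jac A f x = 0 := by
    intro f hf hj
    have hc : ContinuousOn (jac A f) (closure Ω) := fun x hx =>
      (analyticAt_jac (hA x hx) (hf x hx)).continuousAt.continuousWithinAt
    exact Set.EqOn.of_subset_closure (f := jac A f) (g := fun _ => 0) hj hc continuousOn_const
      subset_closure subset_rfl
  have hJ : ∀ x ∈ Ω, jac A ψ x = 0 := by
    intro x hx
    have han : ∀ y ∈ Ω, AnalyticAt ℝ (jac A ψ) y := fun y hy =>
      analyticAt_jac (hA y (subset_closure hy)) (hψ y (subset_closure hy))
    have hconst := hΩ.isOpen.is_const_of_fderiv_eq_zero (𝕜 := ℝ) (f := jac A ψ) hΩ.isPreconnected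
      (fun y hy => (han y hy).differentiableAt.differentiableWithinAt)
      (fun y hy => fderiv_jac_eq_zero (hA y (subset_closure hy)) (hψ y (subset_closure hy))
        (hsol.induction y hy)) hx hmem
    rw [hconst]
    simp [jac, hx₀]
  have hB : ∀ x ∈ Ω, jac A (bernoulli A ψ p) x = 0 := fun x hx =>
    jac_bernoulli_eq_zero (hA x (subset_closure hx)) (hψ x (subset_closure hx))
      (hp x (subset_closure hx)) (hsol.momentum x hx) (hJ x hx)
  have hBan : AnalyticOnNhd ℝ (bernoulli A ψ p) (closure Ω) := fun x hx =>
    analyticAt_bernoulli (hA x hx) (hψ x hx) (hp x hx)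
  obtain ⟨G, hG, hGψ⟩ := exists_profile_of_jac hΩ h hψ (extend ψ hψ hJ)
  obtain ⟨H, -, hHb⟩ := exists_profile_of_jac hΩ h hBan (extend _ hBan hB)
  exact ⟨G, H, hG, hGψ, hHb⟩

/-! ### First-order behaviour at the boundary -/

lemma hasDerivAt_line {f : Plane → ℝ} {x : Plane} (hf : DifferentiableAt ℝ f x) (v : Plane) :
    HasDerivAt (fun s : ℝ => f (x + s • v)) (fderiv ℝ f x v) 0 := by
  have h1 : HasDerivAt (fun s : ℝ => x + s • v) v 0 := by
    simpa using ((hasDerivAt_id (0 : ℝ)).smul_const v).const_add x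
  have h2 : HasFDerivAt f (fderiv ℝ f x) (x + (0 : ℝ) • v) := by simpa using hf.hasFDerivAt
  exact h2.comp_hasDerivAt (0 : ℝ) h1

namespace IsFlux

variable {Ω : Set Plane} {a : Plane → ℝ} {x₀ : Plane}

lemma eventually_line_mem (h : IsFlux Ω a x₀) {x : Plane} (hx : x ∈ frontier Ω) {v : Plane}
    (hv : 0 < fderiv ℝ a x v) : ∀ᶠ s : ℝ in 𝓝[>] 0, x + s • v ∈ Ω := by
  have hd := hasDerivAt_line (h.analytic x (frontier_subset_closure hx)).differentiableAt v
  have h1 : ∀ᶠ s : ℝ in 𝓝[>] 0, 0 < a (x + s • v) := by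
    have := hd.hasDerivWithinAt (s := Ioi 0)
    rw [hasDerivWithinAt_iff_tendsto_slope' (by simp)] at this
    filter_upwards [this.eventually_const_lt hv, self_mem_nhdsWithin] with s hs hs0
    simp only [slope, zero_smul, add_zero, vsub_eq_sub, h.zero x hx, sub_zero, smul_eq_mul] at hs
    exact (mul_pos_iff_of_pos_left (inv_pos.2 hs0)).1 hs
  have hc : Tendsto (fun s : ℝ => x + s • v) (𝓝[>] 0) (𝓝 x) := by
    have : Continuous fun s : ℝ => x + s • v := by fun_prop
    have h2 := this.tendsto 0
    simp only [zero_smul, add_zero] at h2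
    exact h2.mono_left nhdsWithin_le_nhds
  filter_upwards [h1, hc.eventually (h.eventually_mem_iff hx)] with s h1 h2 using h2.1.2 h1

lemma exists_inward (h : IsFlux Ω a x₀) {x : Plane} (hx : x ∈ frontier Ω) :
    ∃ v, 0 < fderiv ℝ a x v := by
  by_contra hcon
  push Not at hcon
  refine h.regular_frontier hx ?_
  ext v
  have h1 := hcon v
  have h2 := hcon (-v)
  rw [map_neg] at h2
  rw [zero_apply]
  linarith

/-- The relation f = G(a) is known only on the closure of Ω, so the chain rule is applied
one-sidedly, along directions entering Ω. Such directions span the plane. -/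
lemma fderiv_eq_of_profile (h : IsFlux Ω a x₀) {f : Plane → ℝ} {G : ℝ → ℝ}
    (hG : DifferentiableAt ℝ G 0) (hfG : ∀ x ∈ closure Ω, f x = G (a x)) {x : Plane}
    (hx : x ∈ frontier Ω) (hf : DifferentiableAt ℝ f x) :
    fderiv ℝ f x = deriv G 0 • fderiv ℝ a x := by
  have had := (h.analytic x (frontier_subset_closure hx)).differentiableAt
  have hpos : ∀ v, 0 < fderiv ℝ a x v → fderiv ℝ f x v = deriv G 0 * fderiv ℝ a x v := by
    intro v hv
    have h1 := hasDerivAt_line hf v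
    have h2 : HasDerivAt G (deriv G 0) (a (x + (0 : ℝ) • v)) := by
      simpa [h.zero x hx] using hG.hasDerivAt
    have h3 := h2.comp (0 : ℝ) (hasDerivAt_line had v)
    refine (uniqueDiffWithinAt_Ioi (0 : ℝ)).eq_deriv (Ioi (0 : ℝ)) h1.hasDerivWithinAt
      (h3.hasDerivWithinAt.congr_of_eventuallyEq ?_ ?_)
    · filter_upwards [h.eventually_line_mem hx hv] with s hs using hfG _ (subset_closure hs)
    · have := hfG x (frontier_subset_closure hx)
      simpa using this
  obtain ⟨v, hv⟩ := h.exists_inward hx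
  ext w
  -- Adding a large multiple of the inward v makes w + t v inward as well.
  obtain ⟨t, ht⟩ := exists_gt (-(fderiv ℝ a x w) / fderiv ℝ a x v)
  rw [div_lt_iff₀ hv] at ht
  have h1 := hpos v hv
  have h2 := hpos (w + t • v) (by simp; linarith)
  simp only [map_add, map_smul, smul_eq_mul] at h2
  simp only [smul_apply, smul_eq_mul]
  linear_combination h2 - t * h1

/-- Directions with v · n < 0 enter Ω, where a > 0, so da ≥ 0 on them. If da(v) = 0 and v · n < 0,
then subtracting a small multiple of a vector with da > 0 would keep the direction entering Ω but
make da negative. -/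
lemma inner_normal_eq_zero (h : IsFlux Ω a x₀) {x n : Plane} (hx : x ∈ frontier Ω)
    (hn : IsOutwardUnitNormal Ω x n) {v : Plane} (hv : fderiv ℝ a x v = 0) :
    inner ℝ v n = 0 := by
  have had := (h.analytic x (frontier_subset_closure hx)).differentiableAt
  have key : ∀ w, inner ℝ w n < 0 → 0 ≤ fderiv ℝ a x w := by
    intro w hw
    have hd := (hasDerivAt_line had w).hasDerivWithinAt (s := Ioi 0)
    rw [hasDerivWithinAt_iff_tendsto_slope' (by simp)] at hd
    refine ge_of_tendsto hd ?_
    filter_upwards [hn.inward w hw, self_mem_nhdsWithin] with s hs hs0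
    simp only [slope, zero_smul, add_zero, vsub_eq_sub, h.zero x hx, sub_zero, smul_eq_mul]
    exact mul_nonneg (inv_nonneg.2 (le_of_lt hs0)) (h.pos _ hs).le
  have main : ∀ v, fderiv ℝ a x v = 0 → ¬ inner ℝ v n < 0 := by
    intro v hv hlt
    obtain ⟨w, hw⟩ := h.exists_inward hx
    have hc : Continuous fun t : ℝ => inner ℝ (v - t • w) n := by fun_prop
    have he : ∀ᶠ t in 𝓝[>] (0 : ℝ), inner ℝ (v - t • w) n < 0 := by
      have := hc.tendsto 0
      simp only [zero_smul, sub_zero] at this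
      exact (this.mono_left nhdsWithin_le_nhds).eventually_lt_const hlt
    obtain ⟨t, ht, ht0⟩ := (he.and self_mem_nhdsWithin).exists
    have := key _ ht
    simp only [map_sub, map_smul, smul_eq_mul, hv] at this
    have := mul_pos (show 0 < t from ht0) hw
    linarith
  rcases lt_trichotomy (inner ℝ v n) 0 with hlt | heq | hgt
  · exact (main v hv hlt).elim
  · exact heq
  · refine (main (-v) (by simp [hv]) ?_).elim
    rw [inner_neg_left]
    linarith

end IsFlux

/-- The gradients of the two potentials are proportional on the boundary. -/
lemma fderiv_eq_smul_of_profile {Ω : Set Plane} {A : Plane → ℝ} {x₀ : Plane}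
    (h : IsFlux Ω A x₀ ∨ IsFlux Ω (fun x => -A x) x₀) {f : Plane → ℝ} {G : ℝ → ℝ}
    (hG : DifferentiableAt ℝ G 0) (hfG : ∀ x ∈ closure Ω, f x = G (A x)) {x : Plane}
    (hx : x ∈ frontier Ω) (hf : DifferentiableAt ℝ f x) :
    fderiv ℝ f x = deriv G 0 • fderiv ℝ A x := by
  rcases h with h | h
  · exact h.fderiv_eq_of_profile hG hfG hx hf
  · have hG' : HasDerivAt (fun c => G (-c)) (-deriv G 0) 0 := by
      have h1 : HasDerivAt G (deriv G 0) (-0) := by simpa using hG.hasDerivAt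
      simpa [Function.comp_def] using h1.comp (0 : ℝ) (hasDerivAt_neg (0 : ℝ))
    have := h.fderiv_eq_of_profile hG'.differentiableAt (fun x hx => by simpa using hfG x hx) hx hf
    rw [this, hG'.deriv, fderiv_fun_neg, neg_smul_neg]

/-- Under the strict inequality on the boundary field, the boundary pressure is positive. -/
lemma pressure_pos {Ω : Set Plane} {A ψ p : Plane → ℝ} {x₀ : Plane}
    (h : IsFlux Ω A x₀ ∨ IsFlux Ω (fun x => -A x) x₀) {G H : ℝ → ℝ}
    (hprof : IsProfile Ω A ψ p G H) (hψ : AnalyticOnNhd ℝ ψ (closure Ω)) {x : Plane}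
    (hx : x ∈ frontier Ω) (hA0 : A x = 0)
    (hineq : -2 * H 0 < (1 - |deriv G 0| ^ 2) * ‖gradPerp A x‖ ^ 2) : 0 < p x := by
  have hxc := frontier_subset_closure hx
  have hb := hprof.bernoulli x hxc
  have hd := fderiv_eq_smul_of_profile h hprof.differentiableAt hprof.stream hx
    (hψ x hxc).differentiableAt
  have hn : ‖gradPerp ψ x‖ ^ 2 = deriv G 0 ^ 2 * ‖gradPerp A x‖ ^ 2 := by
    rw [norm_gradPerp_sq, norm_gradPerp_sq, hd]
    simp
    ring
  rw [hA0, hn] at hb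
  rw [sq_abs] at hineq
  linarith

/-! ### Holomorphic extension from the real line -/

/-- A real-analytic function of a real variable extends holomorphically near each point. -/
lemma exists_local_extension {f : ℝ → ℂ} {t : ℝ} (hf : AnalyticAt ℝ f t) :
    ∃ ρ > 0, ∃ F : ℂ → ℂ, DifferentiableOn ℂ F (Metric.ball (t : ℂ) ρ) ∧
      ∀ s : ℝ, (s : ℂ) ∈ Metric.ball (t : ℂ) ρ → F s = f s := by
  obtain ⟨p, r, hp⟩ := hf
  -- The same Taylor coefficients, read as a complex power series; equal coefficient norms give no
  -- smaller radius.
  let q : FormalMultilinearSeries ℂ ℂ ℂ := fun n =>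
    ContinuousMultilinearMap.mkPiRing ℂ (Fin n) (p.coeff n)
  have hcoeff : ∀ n, q.coeff n = p.coeff n := fun n => by
    change ContinuousMultilinearMap.mkPiRing ℂ (Fin n) (p.coeff n) 1 = p.coeff n
    simp
  have hrad : p.radius ≤ q.radius := by
    refine FormalMultilinearSeries.radius_le_of_le fun n => ?_
    rw [FormalMultilinearSeries.norm_apply_eq_norm_coef,
      FormalMultilinearSeries.norm_apply_eq_norm_coef, hcoeff]
  have hrq : r ≤ q.radius := hp.r_le.trans hrad
  obtain ⟨ρ, hρ0, hρ⟩ := ENNReal.lt_iff_exists_nnreal_btwn.1 hp.r_pos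
  have hq := q.hasFPowerSeriesOnBall (hp.r_pos.trans_le hrq)
  refine ⟨ρ, by exact_mod_cast hρ0, fun z => q.sum (z - t), ?_, ?_⟩
  · have h1 := hq.differentiableOn
    refine h1.comp (by fun_prop) ?_
    intro z hz
    rw [Metric.mem_eball, edist_eq_enorm_sub, sub_zero]
    rw [Metric.mem_ball, dist_eq_norm] at hz
    refine lt_of_lt_of_le ?_ (hρ.le.trans hrq)
    rw [← ofReal_norm, ← ENNReal.ofReal_coe_nnreal]
    exact (ENNReal.ofReal_lt_ofReal_iff_of_nonneg (norm_nonneg _)).2 hz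
  · intro s hs
    have hs' : s - t ∈ Metric.eball (0 : ℝ) r := by
      rw [Metric.mem_eball, edist_eq_enorm_sub, sub_zero]
      rw [Metric.mem_ball, dist_eq_norm, ← Complex.ofReal_sub, Complex.norm_real] at hs
      refine lt_of_lt_of_le ?_ hρ.le
      rw [← ofReal_norm, ← ENNReal.ofReal_coe_nnreal]
      exact (ENNReal.ofReal_lt_ofReal_iff_of_nonneg (norm_nonneg _)).2 hs
    have h2 := hp.sum hs'
    rw [add_sub_cancel] at h2
    rw [h2]
    simp only [FormalMultilinearSeries.sum]
    refine tsum_congr fun n => ?_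
    rw [FormalMultilinearSeries.apply_eq_pow_smul_coeff,
      FormalMultilinearSeries.apply_eq_pow_smul_coeff, hcoeff]
    simp [Complex.real_smul]

/-- Holomorphic functions on a convex open set that agree on its real points are equal. -/
lemma eqOn_of_eq_real {U : Set ℂ} (hU : IsOpen U) (hc : Convex ℝ U) {F₁ F₂ : ℂ → ℂ}
    (h₁ : DifferentiableOn ℂ F₁ U) (h₂ : DifferentiableOn ℂ F₂ U) {t : ℝ} (ht : (t : ℂ) ∈ U)
    (h : ∀ s : ℝ, (s : ℂ) ∈ U → F₁ s = F₂ s) : EqOn F₁ F₂ U := by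
  refine AnalyticOnNhd.eqOn_of_preconnected_of_frequently_eq (h₁.analyticOnNhd hU)
    (h₂.analyticOnNhd hU) hc.isPreconnected ht ?_
  have htend : Tendsto (fun s : ℝ => (s : ℂ)) (𝓝[≠] t) (𝓝[≠] (t : ℂ)) := by
    refine tendsto_nhdsWithin_iff.2
      ⟨(Complex.continuous_ofReal.tendsto t).mono_left nhdsWithin_le_nhds, ?_⟩
    filter_upwards [self_mem_nhdsWithin] with s hs
    simpa using hs
  refine htend.frequently (Eventually.frequently ?_)
  have : ∀ᶠ s : ℝ in 𝓝[≠] t, (s : ℂ) ∈ U :=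
    (htend.mono_right nhdsWithin_le_nhds).eventually (hU.mem_nhds ht)
  exact this.mono h

/-- A periodic real-analytic function extends to a periodic holomorphic function on a strip. -/
theorem exists_periodic_extension {f : ℝ → ℂ} (hf : ∀ t, AnalyticAt ℝ f t)
    (hper : Function.Periodic f 1) :
    ∃ r > 0, ∃ Φ : ℂ → ℂ, DifferentiableOn ℂ Φ {z | |z.im| < r} ∧ (∀ s : ℝ, Φ s = f s) ∧
      ∀ z : ℂ, |z.im| < r → Φ (z + 1) = Φ z := by
  choose ρ hρ F hFd hFf using fun t => exists_local_extension (hf t)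
  have hcov : (fun s : ℝ => (s : ℂ)) '' Icc 0 1 ⊆ ⋃ t : ℝ, Metric.ball (t : ℂ) (ρ t) := by
    rintro _ ⟨s, -, rfl⟩
    exact mem_iUnion.2 ⟨s, Metric.mem_ball_self (hρ s)⟩
  -- A Lebesgue number over one period gives a common radius r; integer translations carry it to
  -- every real centre.
  obtain ⟨r, hr, hleb⟩ := lebesgue_number_lemma_of_metric
    (isCompact_Icc.image Complex.continuous_ofReal) (fun _ => Metric.isOpen_ball) hcov
  have key : ∀ t : ℝ, ∃ E : ℂ → ℂ, DifferentiableOn ℂ E (Metric.ball (t : ℂ) r) ∧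
      ∀ s : ℝ, (s : ℂ) ∈ Metric.ball (t : ℂ) r → E s = f s := by
    intro t
    obtain ⟨i, hi⟩ := hleb (Int.fract t : ℝ)
      ⟨Int.fract t, ⟨Int.fract_nonneg t, (Int.fract_lt_one t).le⟩, rfl⟩
    have hshift : ∀ z ∈ Metric.ball (t : ℂ) r, z - (⌊t⌋ : ℝ) ∈ Metric.ball (i : ℂ) (ρ i) := by
      intro z hz
      apply hi
      rw [Metric.mem_ball, dist_eq_norm] at hz ⊢
      rw [Int.fract]
      push_cast
      convert hz using 2
      ring
    refine ⟨fun z => F i (z - (⌊t⌋ : ℝ)), (hFd i).comp (by fun_prop) hshift, fun s hs => ?_⟩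
    have h1 := hshift s hs
    rw [← Complex.ofReal_sub] at h1
    change F i ((s : ℂ) - (⌊t⌋ : ℝ)) = f s
    rw [← Complex.ofReal_sub, hFf i _ h1]
    simpa using hper.sub_zsmul_eq (x := s) ⌊t⌋
  choose E hEd hEf using key
  have hproj : ∀ (t : ℝ) (z : ℂ), z ∈ Metric.ball (t : ℂ) r →
      ((z.re : ℝ) : ℂ) ∈ Metric.ball (t : ℂ) r := by
    intro t z hz
    rw [Metric.mem_ball, dist_eq_norm] at hz ⊢
    refine lt_of_le_of_lt ?_ hz
    rw [← Complex.ofReal_sub, Complex.norm_real]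
    simpa using Complex.abs_re_le_norm (z - t)
  have hself : ∀ z : ℂ, |z.im| < r → z ∈ Metric.ball ((z.re : ℝ) : ℂ) r := by
    intro z hz
    rw [Metric.mem_ball, dist_eq_norm]
    have : z - (z.re : ℂ) = (z.im : ℂ) * Complex.I := by
      apply Complex.ext <;> simp
    rw [this]
    simpa using hz
  have hglue : ∀ (t : ℝ) (z : ℂ), z ∈ Metric.ball (t : ℂ) r → |z.im| < r →
      E z.re z = E t z := by
    intro t z hz hzr
    have := eqOn_of_eq_real (U := Metric.ball ((z.re : ℝ) : ℂ) r ∩ Metric.ball (t : ℂ) r)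
      (Metric.isOpen_ball.inter Metric.isOpen_ball)
      ((convex_ball _ _).inter (convex_ball _ _))
      ((hEd z.re).mono inter_subset_left) ((hEd t).mono inter_subset_right)
      (t := z.re) ⟨Metric.mem_ball_self hr, hproj t z hz⟩
      (fun s hs => by rw [hEf _ s hs.1, hEf _ s hs.2])
    exact this ⟨hself z hzr, hz⟩
  have hopen : IsOpen {z : ℂ | |z.im| < r} :=
    isOpen_lt (Complex.continuous_im.abs) continuous_const
  -- Each point uses the disc centred at its own real part. By the identity theorem, this agrees
  -- near any z with one fixed holomorphic branch.
  refine ⟨r, hr, fun z => E z.re z, ?_, ?_, ?_⟩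
  · intro z hz
    have hz' : |z.im| < r := hz
    have hd : DifferentiableAt ℂ (E z.re) z :=
      (hEd z.re).differentiableAt (Metric.isOpen_ball.mem_nhds (hself z hz'))
    refine (hd.congr_of_eventuallyEq ?_).differentiableWithinAt
    filter_upwards [hopen.mem_nhds hz, Metric.isOpen_ball.mem_nhds (hself z hz')] with w hw hwb
    exact hglue z.re w hwb hw
  · intro s
    exact hEf _ s (Metric.mem_ball_self hr)
  · intro z hz
    have hshift : ∀ w ∈ Metric.ball ((z.re : ℝ) : ℂ) r,
        w + 1 ∈ Metric.ball (((z + 1).re : ℝ) : ℂ) r := by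
      intro w hw
      rw [Metric.mem_ball, dist_eq_norm] at hw ⊢
      convert hw using 2
      simp
    have := eqOn_of_eq_real (U := Metric.ball ((z.re : ℝ) : ℂ) r) Metric.isOpen_ball
      (convex_ball _ _) (F₁ := fun w => E (z + 1).re (w + 1)) (F₂ := E z.re)
      ((hEd _).comp (by fun_prop) hshift) (hEd _) (t := z.re) (Metric.mem_ball_self hr)
      (fun s hs => by
        have h1 := hshift s hs
        have h2 : ((s : ℂ) + 1) = ((s + 1 : ℝ) : ℂ) := by push_cast; rfl
        rw [h2] at h1 ⊢
        rw [hEf _ _ h1, hEf _ _ hs, hper s])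
    exact this (hself z hz)

/-- A primitive of a real-analytic function is real analytic. -/
lemma analyticAt_of_hasDerivAt {g w : ℝ → ℝ} (hw : ∀ t, AnalyticAt ℝ w t)
    (hg : ∀ t, HasDerivAt g (w t) t) (t : ℝ) : AnalyticAt ℝ g t := by
  have hwc : AnalyticAt ℝ (fun s => (w s : ℂ)) t :=
    (Complex.ofRealCLM.analyticAt _).comp (hw t)
  obtain ⟨ρ, hρ, F, hFd, hFw⟩ := exists_local_extension hwc
  -- On the real axis Re P has derivative w, so it differs from g by a constant.
  obtain ⟨P, hP⟩ := hFd.isExactOn_ball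
  have hPan : AnalyticAt ℂ P t :=
    DifferentiableOn.analyticAt (s := Metric.ball (t : ℂ) ρ)
      (fun z hz => (hP z hz).differentiableAt.differentiableWithinAt)
      (Metric.ball_mem_nhds _ hρ)
  have hre : AnalyticAt ℝ (fun s : ℝ => (P s).re) t :=
    (Complex.reCLM.analyticAt _).comp
      ((hPan.restrictScalars (𝕜 := ℝ)).comp (Complex.ofRealCLM.analyticAt t))
  have hmem : ∀ s ∈ Metric.ball t ρ, (s : ℂ) ∈ Metric.ball (t : ℂ) ρ := by
    intro s hs
    rwa [Metric.mem_ball, dist_eq_norm, ← Complex.ofReal_sub, Complex.norm_real,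
      ← dist_eq_norm]
  have hd : ∀ s ∈ Metric.ball t ρ, HasDerivAt (fun s : ℝ => g s - (P s).re) 0 s := by
    intro s hs
    have h1 := (hP s (hmem s hs)).real_of_complex
    rw [hFw s (hmem s hs), Complex.ofReal_re] at h1
    have h2 := (hg s).sub h1
    rw [sub_self] at h2
    exact h2
  have hconst : ∀ s ∈ Metric.ball t ρ, g s - (P s).re = g t - (P t).re := fun s hs =>
    Metric.isOpen_ball.is_const_of_deriv_eq_zero (f := fun s : ℝ => g s - (P s).re)
      (convex_ball t ρ).isPreconnected
      (fun s hs => (hd s hs).differentiableAt.differentiableWithinAt)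
      (fun s hs => (hd s hs).deriv) hs (Metric.mem_ball_self hρ)
  refine (hre.add (analyticAt_const (v := g t - (P t).re))).congr ?_
  filter_upwards [Metric.ball_mem_nhds t hρ] with s hs
  have := hconst s hs
  simp only [Pi.add_apply]
  linarith

/-! ### Reparametrization of Jordan curves -/

namespace IsJordanParam

variable {n : WithTop ℕ∞} {γ : ℝ → Plane}

lemma add_int (h : Function.Periodic γ 1) (t : ℝ) (k : ℤ) : γ (t + k) = γ t := by
  simpa using h.zsmul k t

/-- Unlike injectivity on one period, this form passes directly to reparametrizations and to the
holomorphic extension. -/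
lemma eq_iff (h : IsJordanParam n γ) {s t : ℝ} : γ s = γ t ↔ ∃ k : ℤ, s = t + k := by
  constructor
  · intro hst
    have hf : ∀ u, γ (Int.fract u) = γ u := fun u => by
      have := add_int h.periodic (Int.fract u) ⌊u⌋
      rw [Int.fract_add_floor] at this
      exact this.symm
    have : Int.fract s = Int.fract t :=
      h.injOn ⟨Int.fract_nonneg s, Int.fract_lt_one s⟩ ⟨Int.fract_nonneg t, Int.fract_lt_one t⟩
        (by rw [hf, hf, hst])
    refine ⟨⌊s⌋ - ⌊t⌋, ?_⟩
    rw [Int.fract, Int.fract] at this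
    push_cast
    linarith
  · rintro ⟨k, rfl⟩
    exact add_int h.periodic t k

lemma of_eq_iff (hc : ContDiff ℝ n γ) (heq : ∀ s t, γ s = γ t ↔ ∃ k : ℤ, s = t + k)
    (hreg : ∀ t, deriv γ t ≠ 0) : IsJordanParam n γ where
  contDiff := hc
  periodic t := (heq _ _).2 ⟨1, by simp⟩
  injOn := by
    rintro s ⟨hs0, hs1⟩ t ⟨ht0, ht1⟩ hst
    obtain ⟨k, hk⟩ := (heq s t).1 hst
    have h1 : (k : ℝ) < 1 := by linarith
    have h2 : (-1 : ℝ) < k := by linarith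
    have h1' : k < 1 := by exact_mod_cast h1
    have h2' : -1 < k := by exact_mod_cast h2
    have : k = 0 := by lia
    simpa [this] using hk
  regular := hreg

/-- The same curve traversed backwards. -/
lemma reverse (h : IsJordanParam n γ) : IsJordanParam n fun t => γ (-t) := by
  refine of_eq_iff (h.contDiff.comp contDiff_neg) (fun s t => ?_) (fun t => ?_)
  · rw [h.eq_iff]
    constructor
    · rintro ⟨k, hk⟩
      exact ⟨-k, by push_cast; linarith⟩
    · rintro ⟨k, hk⟩
      exact ⟨-k, by push_cast; linarith⟩
  · rw [deriv_comp_neg]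
    exact neg_ne_zero.2 (h.regular _)

/-- Analytic reparametrization with speed inversely proportional to a positive weight. -/
theorem exists_reparam (h : IsJordanParam ω γ) {m : Plane → ℝ} (hm : ∀ t, 0 < m (γ t))
    (hma : ∀ t, AnalyticAt ℝ (fun t => m (γ t)) t) :
    ∃ (η : ℝ → Plane) (κ : ℝ), IsJordanParam ω η ∧ range η = range γ ∧ 0 < κ ∧
      ∀ s, ‖deriv η s‖ * m (η s) = κ := by
  have hγan : ∀ t, AnalyticAt ℝ γ t := fun t => h.contDiff.contDiffAt.analyticAt
  have hγd : ∀ t, DifferentiableAt ℝ γ t := fun t => (hγan t).differentiableAt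
  let w : ℝ → ℝ := fun t => m (γ t) * ‖deriv γ t‖
  have hwpos : ∀ t, 0 < w t := fun t => mul_pos (hm t) (norm_pos_iff.2 (h.regular t))
  have hwan : ∀ t, AnalyticAt ℝ w t := fun t =>
    (hma t).mul ((hγan t).deriv.contDiffAt (n := ω) |>.norm ℝ (h.regular t)).analyticAt
  have hwc : Continuous w := continuous_iff_continuousAt.2 fun t => (hwan t).continuousAt
  have hdper : Function.Periodic (deriv γ) 1 := fun t => by
    rw [← deriv_comp_add_const]
    exact congrArg (fun f => deriv f t) (funext h.periodic)
  have hwper : Function.Periodic w 1 := fun t => by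
    simp only [w, h.periodic t, hdper t]
  let κ : ℝ := ∫ t in (0 : ℝ)..1, w t
  have hκ : 0 < κ := intervalIntegral.intervalIntegral_pos_of_pos (hwc.intervalIntegrable _ _)
    hwpos one_pos
  -- Weighted arclength, normalized so that one period has length 1 and g(t + k) = g(t) + k. The new
  -- parameter is g.
  let g : ℝ → ℝ := fun t => (∫ x in (0 : ℝ)..t, w x) / κ
  have hgd : ∀ t, HasDerivAt g (w t / κ) t := fun t =>
    (intervalIntegral.integral_hasDerivAt_right (hwc.intervalIntegrable _ _)
      hwc.aestronglyMeasurable.stronglyMeasurableAtFilter hwc.continuousAt).div_const κ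
  have hgd0 : ∀ t, w t / κ ≠ 0 := fun t => (div_pos (hwpos t) hκ).ne'
  have hgan : ∀ t, AnalyticAt ℝ g t :=
    analyticAt_of_hasDerivAt (fun t => (hwan t).div analyticAt_const hκ.ne') hgd
  have hgc : Continuous g := continuous_iff_continuousAt.2 fun t => (hgan t).continuousAt
  have hg0 : g 0 = 0 := by simp [g]
  have hgper : Function.Periodic (fun t => g t - t) 1 := by
    intro t
    have h1 : ∫ x in (0 : ℝ)..(t + 1), w x = (∫ x in (0 : ℝ)..t, w x) + κ := by
      rw [← intervalIntegral.integral_add_adjacent_intervals (b := t)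
        (hwc.intervalIntegrable _ _) (hwc.intervalIntegrable _ _),
        hwper.intervalIntegral_add_eq t 0, zero_add]
    simp only [g, h1, add_div, div_self hκ.ne']
    ring
  have hgint : ∀ (t : ℝ) (k : ℤ), g (t + k) = g t + k := by
    intro t k
    have := hgper.zsmul k t
    simp only [zsmul_eq_mul, mul_one] at this
    linarith
  have hmono : StrictMono g := strictMono_of_deriv_pos fun t => by
    rw [(hgd t).deriv]
    exact div_pos (hwpos t) hκ
  have hsurj : Function.Surjective g := by
    intro y
    have h1 := hgint 0 ⌊y⌋
    have h2 := hgint 0 (⌊y⌋ + 1)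
    simp only [hg0, zero_add] at h1 h2
    have hle : ((⌊y⌋ : ℤ) : ℝ) ≤ ((⌊y⌋ + 1 : ℤ) : ℝ) := by push_cast; linarith
    obtain ⟨t, -, ht⟩ := intermediate_value_Icc hle hgc.continuousOn
      (show y ∈ Icc (g (⌊y⌋ : ℤ)) (g ((⌊y⌋ + 1 : ℤ) : ℝ)) by
        rw [h1, h2]
        exact ⟨Int.floor_le y, by push_cast; exact (Int.lt_floor_add_one y).le⟩)
    exact ⟨t, ht⟩
  let e : ℝ ≃ₜ ℝ := (StrictMono.orderIsoOfSurjective g hmono hsurj).toHomeomorph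
  have hge : ∀ s, g (e.symm s) = s := fun s => e.apply_symm_apply s
  have hTc : ContDiff ℝ ω e.symm := e.contDiff_symm_deriv (f' := fun t => w t / κ) hgd0 hgd
    (contDiff_omega_iff_analyticOnNhd.2 fun t _ => hgan t)
  have hTd : ∀ s, HasDerivAt e.symm (w (e.symm s) / κ)⁻¹ s := fun s =>
    HasDerivAt.of_local_left_inverse e.symm.continuous.continuousAt (hgd _) (hgd0 _)
      (Eventually.of_forall hge)
  have hηd : ∀ s, deriv (fun s => γ (e.symm s)) s
      = (w (e.symm s) / κ)⁻¹ • deriv γ (e.symm s) := fun s =>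
    ((hγd _).hasDerivAt.scomp s (hTd s)).deriv
  refine ⟨fun s => γ (e.symm s), κ, of_eq_iff (h.contDiff.comp hTc) (fun s t => ?_) (fun s => ?_),
    e.symm.surjective.range_comp γ, hκ, fun s => ?_⟩
  · rw [h.eq_iff]
    constructor
    · rintro ⟨k, hk⟩
      refine ⟨k, ?_⟩
      have := congrArg g hk
      rwa [hgint, hge, hge] at this
    · rintro ⟨k, hk⟩
      refine ⟨k, hmono.injective ?_⟩
      rw [hgint, hge, hge, hk]
  · rw [hηd]
    exact smul_ne_zero (inv_ne_zero (hgd0 _)) (h.regular _)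
  · rw [hηd, norm_smul, norm_inv, Real.norm_of_nonneg (div_pos (hwpos _) hκ).le]
    have h1 := (hm (e.symm s)).ne'
    have h2 : ‖deriv γ (e.symm s)‖ ≠ 0 := norm_ne_zero_iff.2 (h.regular _)
    simp only [w]
    field_simp

end IsJordanParam

/-! ### The conformal collar of the boundary -/

/-- The isometry `x + iy ↦ (x, y)` of the complex line with the plane. -/
def toPlane : ℂ ≃ₗᵢ[ℝ] Plane := Complex.orthonormalBasisOneI.repr

lemma toPlane_zero (z : ℂ) : toPlane z 0 = z.re := by simp [toPlane]

lemma toPlane_one (z : ℂ) : toPlane z 1 = z.im := by simp [toPlane]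

lemma hasDerivAt_toPlane_comp {Φ : ℂ → ℂ} {z : ℝ → ℂ} {v : ℂ} {τ : ℝ}
    (hΦ : DifferentiableAt ℂ Φ (z τ)) (hz : HasDerivAt z v τ) :
    HasDerivAt (fun τ => toPlane (Φ (z τ))) (toPlane (v * deriv Φ (z τ))) τ := by
  have h1 := hΦ.hasDerivAt.scomp τ hz
  exact (toPlane.toContinuousLinearEquiv : ℂ →L[ℝ] Plane).hasFDerivAt.comp_hasDerivAt τ h1

lemma hasDerivAt_comp_path {f : Plane → ℝ} {Φ : ℂ → ℂ} {z : ℝ → ℂ} {v : ℂ} {τ : ℝ}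
    (hf : DifferentiableAt ℝ f (toPlane (Φ (z τ)))) (hΦ : DifferentiableAt ℂ Φ (z τ))
    (hz : HasDerivAt z v τ) :
    HasDerivAt (fun τ => f (toPlane (Φ (z τ))))
      (fderiv ℝ f (toPlane (Φ (z τ))) (toPlane (v * deriv Φ (z τ)))) τ :=
  hf.hasFDerivAt.comp_hasDerivAt τ (hasDerivAt_toPlane_comp hΦ hz)

/-- The open strip of half-width `r` about the real axis. -/
def strip (r : ℝ) : Set ℂ := {z | |z.im| < r}

lemma isOpen_strip (r : ℝ) : IsOpen (strip r) :=
  isOpen_lt Complex.continuous_im.abs continuous_const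

lemma strip_subset {r s : ℝ} (h : r ≤ s) : strip r ⊆ strip s := fun _ hz =>
  lt_of_lt_of_le (b := r) hz h

lemma ofReal_mem_strip {r : ℝ} (hr : 0 < r) (t : ℝ) : (t : ℂ) ∈ strip r := by
  simpa [strip] using hr

/-- A conformal parametrization of a neighbourhood of `∂Ω` by a strip, the lower half of which is
mapped into `Ω` and the upper half outside. -/
structure IsCollar (Ω : Set Plane) (Φ : ℂ → ℂ) (r : ℝ) : Prop where
  pos : 0 < r
  differentiableOn : DifferentiableOn ℂ Φ (strip r)
  eq_iff : ∀ z ∈ strip r, ∀ w ∈ strip r, Φ z = Φ w ↔ ∃ k : ℤ, z = w + (k : ℂ)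
  deriv_ne : ∀ z ∈ strip r, deriv Φ z ≠ 0
  outside : ∀ z ∈ strip r, 0 < z.im → toPlane (Φ z) ∉ closure Ω
  inside : ∀ z ∈ strip r, z.im < 0 → toPlane (Φ z) ∈ Ω
  boundary : range (fun t : ℝ => toPlane (Φ t)) = frontier Ω

/-- Compactness of [0, 1] turns a condition holding near each real point into one on a thin
rectangle; periodicity later extends it to a strip. -/
lemma exists_strip_of_eventually {P : ℂ → Prop}
    (hP : ∀ t : ℝ, ∀ᶠ z in 𝓝 (t : ℂ), P z) :
    ∃ δ > 0, ∀ z : ℂ, z.re ∈ Icc 0 1 → z ∈ strip δ → P z := by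
  obtain ⟨δ, hδ, hsub⟩ := (isCompact_Icc.image Complex.continuous_ofReal :
    IsCompact (Complex.ofReal '' Icc 0 1)).exists_thickening_subset_open
    (isOpen_interior (s := {z | P z})) (by
      rintro _ ⟨t, -, rfl⟩
      exact mem_interior_iff_mem_nhds.2 (hP t))
  refine ⟨δ, hδ, fun z hz hzδ => interior_subset (hsub ?_)⟩
  refine Metric.mem_thickening_iff.2 ⟨z.re, ⟨z.re, hz, rfl⟩, ?_⟩
  have : z - (z.re : ℂ) = (z.im : ℂ) * Complex.I := by
    apply Complex.ext <;> simp
  rw [dist_eq_norm, this]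
  simpa [strip] using hzδ

lemma exists_strip_of_eventually₂ {P : ℂ × ℂ → Prop}
    (hP : ∀ s t : ℝ, ∀ᶠ z in 𝓝 ((s : ℂ), (t : ℂ)), P z) :
    ∃ δ > 0, ∀ z w : ℂ, z.re ∈ Icc 0 1 → w.re ∈ Icc 0 1 → z ∈ strip δ → w ∈ strip δ →
      P (z, w) := by
  have hK : IsCompact ((Complex.ofReal '' Icc 0 1) ×ˢ (Complex.ofReal '' Icc 0 1)) :=
    (isCompact_Icc.image Complex.continuous_ofReal).prod
      (isCompact_Icc.image Complex.continuous_ofReal)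
  obtain ⟨δ, hδ, hsub⟩ := hK.exists_thickening_subset_open
    (isOpen_interior (s := {z | P z})) (by
      rintro ⟨_, _⟩ ⟨⟨s, -, rfl⟩, ⟨t, -, rfl⟩⟩
      exact mem_interior_iff_mem_nhds.2 (hP s t))
  refine ⟨δ, hδ, fun z w hz hw hzδ hwδ => interior_subset (hsub ?_)⟩
  have him : ∀ z : ℂ, z ∈ strip δ → dist z (z.re : ℂ) < δ := by
    intro z hzδ
    have : z - (z.re : ℂ) = (z.im : ℂ) * Complex.I := by
      apply Complex.ext <;> simp
    rw [dist_eq_norm, this]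
    simpa [strip] using hzδ
  refine Metric.mem_thickening_iff.2 ⟨(z.re, w.re), ⟨⟨z.re, hz, rfl⟩, ⟨w.re, hw, rfl⟩⟩, ?_⟩
  rw [Prod.dist_eq]
  exact max_lt (him z hzδ) (him w hwδ)

lemma periodic_strip_int {Φ : ℂ → ℂ} {r : ℝ} (hper : ∀ z ∈ strip r, Φ (z + 1) = Φ z) {z : ℂ}
    (hz : z ∈ strip r) (k : ℤ) : Φ (z + k) = Φ z := by
  have hmem : ∀ j : ℤ, z + j ∈ strip r := fun j => by simpa [strip] using hz
  induction k using Int.induction_on with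
  | zero => simp
  | succ n ih =>
    rw [← ih, ← hper _ (hmem n)]
    congr 1
    push_cast
    ring
  | pred n ih =>
    rw [← ih, ← hper _ (hmem (-n - 1))]
    congr 1
    push_cast
    ring

lemma eventually_injOn_of_deriv_ne {Φ : ℂ → ℂ} {z : ℂ} (hΦ : AnalyticAt ℂ Φ z)
    (hd : deriv Φ z ≠ 0) : ∃ U ∈ 𝓝 z, InjOn Φ U := by
  have h := hΦ.hasStrictDerivAt.hasStrictFDerivAt_equiv hd
  exact ⟨_, (h.toOpenPartialHomeomorph Φ).open_source.mem_nhds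
    h.mem_toOpenPartialHomeomorph_source, (h.toOpenPartialHomeomorph Φ).injOn⟩

/-- The sides of the boundary curve, distinguished by the sign of the normal derivative. -/
lemma eventually_side {Ω : Set Plane} {a : Plane → ℝ} {x₀ : Plane} (h : IsFlux Ω a x₀)
    {Φ : ℂ → ℂ} {r : ℝ} (hr : 0 < r) (hΦ : DifferentiableOn ℂ Φ (strip r))
    (hfr : ∀ t : ℝ, toPlane (Φ t) ∈ frontier Ω)
    {t : ℝ} (ht : fderiv ℝ a (toPlane (Φ t)) (toPlane (Complex.I * deriv Φ t)) < 0) :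
    ∀ᶠ z in 𝓝 (t : ℂ), (0 < z.im → toPlane (Φ z) ∉ closure Ω) ∧
      (z.im < 0 → toPlane (Φ z) ∈ Ω) := by
  have hts : (t : ℂ) ∈ strip r := ofReal_mem_strip hr t
  have han : AnalyticAt ℂ Φ t := hΦ.analyticAt ((isOpen_strip r).mem_nhds hts)
  have haa : AnalyticAt ℝ a (toPlane (Φ t)) := h.analytic _ (frontier_subset_closure (hfr t))
  have hcΦ : ContinuousAt (fun z => toPlane (Φ z)) t :=
    toPlane.continuous.continuousAt.comp han.continuousAt
  have hcont : ContinuousAt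
      (fun z => fderiv ℝ a (toPlane (Φ z)) (toPlane (Complex.I * deriv Φ z))) t := by
    have h1 : ContinuousAt (fun z => fderiv ℝ a (toPlane (Φ z))) t :=
      ContinuousAt.comp (g := fderiv ℝ a) haa.fderiv.continuousAt hcΦ
    have h2 : ContinuousAt (fun z => toPlane (Complex.I * deriv Φ z)) t :=
      toPlane.continuous.continuousAt.comp (continuousAt_const.mul han.deriv.continuousAt)
    exact h1.clm_apply h2
  have hall : ∀ᶠ z in 𝓝 (t : ℂ),
      fderiv ℝ a (toPlane (Φ z)) (toPlane (Complex.I * deriv Φ z)) < 0 ∧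
      z ∈ strip r ∧ AnalyticAt ℝ a (toPlane (Φ z)) ∧
      (toPlane (Φ z) ∈ Ω ↔ 0 < a (toPlane (Φ z))) ∧
      (toPlane (Φ z) ∈ closure Ω ↔ 0 ≤ a (toPlane (Φ z))) :=
    (hcont.eventually_lt_const ht).and ((((isOpen_strip r).eventually_mem hts)).and
      ((hcΦ.eventually haa.eventually_analyticAt).and
        (hcΦ.eventually (h.eventually_mem_iff (hfr t)))))
  obtain ⟨ε, hε, hball⟩ := Metric.eventually_nhds_iff_ball.1 hall
  filter_upwards [Metric.ball_mem_nhds (t : ℂ) hε] with z hz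
  -- Along the vertical segment through Re z the function a ∘ Φ strictly decreases, and it vanishes
  -- at Re z. Its sign at z is thus opposite to that of Im z.
  let path : ℝ → ℂ := fun τ => (z.re : ℂ) + τ * Complex.I
  have hpath : ∀ τ ∈ Icc (-|z.im|) |z.im|, path τ ∈ Metric.ball (t : ℂ) ε := by
    intro τ hτ
    rw [Metric.mem_ball, dist_eq_norm] at hz ⊢
    refine lt_of_le_of_lt ?_ hz
    rw [← sq_le_sq₀ (norm_nonneg _) (norm_nonneg _), Complex.sq_norm, Complex.sq_norm,
      Complex.normSq_apply, Complex.normSq_apply]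
    have h1 : |τ| ≤ |z.im| := abs_le.2 hτ
    have h2 := sq_le_sq.2 h1
    simp [path]
    nlinarith
  have hpd : ∀ τ, HasDerivAt path Complex.I τ := fun τ => by
    have := ((hasDerivAt_id (τ : ℂ)).comp_ofReal.mul_const Complex.I).const_add (z.re : ℂ)
    simpa [path] using this
  have hd : ∀ τ ∈ Icc (-|z.im|) |z.im|, HasDerivAt (fun τ => a (toPlane (Φ (path τ))))
      (fderiv ℝ a (toPlane (Φ (path τ))) (toPlane (Complex.I * deriv Φ (path τ)))) τ := by
    intro τ hτ
    obtain ⟨-, h2, h3, -⟩ := hball _ (hpath τ hτ)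
    exact hasDerivAt_comp_path h3.differentiableAt
      (hΦ.differentiableAt ((isOpen_strip r).mem_nhds h2)) (hpd τ)
  have hanti : StrictAntiOn (fun τ => a (toPlane (Φ (path τ)))) (Icc (-|z.im|) |z.im|) := by
    refine strictAntiOn_of_deriv_neg (convex_Icc _ _)
      (fun τ hτ => (hd τ hτ).continuousAt.continuousWithinAt) fun τ hτ => ?_
    have hτ' := interior_subset hτ
    rw [(hd τ hτ').deriv]
    exact (hball _ (hpath τ hτ')).1
  have h0 : a (toPlane (Φ (path 0))) = 0 := by
    have : path 0 = (z.re : ℂ) := by simp [path]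
    rw [this]
    exact h.zero _ (hfr _)
  have hzp : path z.im = z := Complex.re_add_im z
  have m0 : (0 : ℝ) ∈ Icc (-|z.im|) |z.im| := ⟨by simp, by simp⟩
  have m1 : z.im ∈ Icc (-|z.im|) |z.im| := ⟨neg_abs_le _, le_abs_self _⟩
  obtain ⟨-, -, -, hi, ho⟩ := hball z hz
  constructor
  · intro hpos
    have := hanti m0 m1 hpos
    simp only [h0, hzp] at this
    rw [ho]
    exact not_le.2 this
  · intro hneg
    have := hanti m1 m0 hneg
    simp only [h0, hzp] at this
    exact hi.2 this

/-- The holomorphic extension of the analytic parametrization has nonzero derivative, is injective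
modulo 1 and separates the two sides locally about the real axis. By compactness and periodicity all
three persist on a thin strip. The hypothesis on i η' says that it points out of Ω. -/
theorem exists_collar {Ω : Set Plane} {a : Plane → ℝ} {x₀ : Plane} (h : IsFlux Ω a x₀)
    {η : ℝ → Plane} (hη : IsJordanParam ω η) (hr : range η = frontier Ω)
    (hor : ∀ t, fderiv ℝ a (η t) (toPlane (Complex.I * toPlane.symm (deriv η t))) < 0) :
    ∃ (Φ : ℂ → ℂ) (r : ℝ), IsCollar Ω Φ r ∧ ∀ t : ℝ, toPlane (Φ t) = η t := by
  have hηan : ∀ t, AnalyticAt ℝ (fun t => toPlane.symm (η t)) t := fun t =>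
    ((toPlane.symm.toContinuousLinearEquiv : Plane →L[ℝ] ℂ).analyticAt _).comp
      hη.contDiff.contDiffAt.analyticAt
  obtain ⟨r, hr0, Φ, hΦd, hΦη, hper⟩ := exists_periodic_extension hηan
    (fun t => by rw [hη.periodic t])
  have hΦη' : ∀ t : ℝ, toPlane (Φ t) = η t := fun t => by rw [hΦη]; simp
  have hfr : ∀ t : ℝ, toPlane (Φ t) ∈ frontier Ω := fun t => by
    rw [hΦη', ← hr]
    exact mem_range_self t
  have hts : ∀ t : ℝ, (t : ℂ) ∈ strip r := ofReal_mem_strip hr0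
  have hnhds : ∀ t : ℝ, strip r ∈ 𝓝 (t : ℂ) := fun t => (isOpen_strip r).mem_nhds (hts t)
  have han : ∀ t : ℝ, AnalyticAt ℂ Φ t := fun t => hΦd.analyticAt (hnhds t)
  have hderiv : ∀ t : ℝ, toPlane (deriv Φ t) = deriv η t := by
    intro t
    have h1 := hasDerivAt_toPlane_comp (z := fun s : ℝ => (s : ℂ)) (v := 1)
      (han t).differentiableAt (by simpa using (hasDerivAt_id (t : ℂ)).comp_ofReal)
    simp only [hΦη', one_mul] at h1
    exact h1.deriv.symm
  have hd0 : ∀ t : ℝ, deriv Φ t ≠ 0 := fun t h0 => hη.regular t (by rw [← hderiv, h0, map_zero])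
  have hside : ∀ t : ℝ, ∀ᶠ z in 𝓝 (t : ℂ), ((0 < z.im → toPlane (Φ z) ∉ closure Ω) ∧
      (z.im < 0 → toPlane (Φ z) ∈ Ω)) ∧ deriv Φ z ≠ 0 := by
    intro t
    refine (eventually_side h hr0 hΦd hfr ?_).and
      ((han t).deriv.continuousAt.eventually_ne (hd0 t))
    rw [hΦη']
    convert hor t using 3
    rw [← hderiv]
    simp
  have hinj : ∀ s t : ℝ, ∀ᶠ z in 𝓝 ((s : ℂ), (t : ℂ)),
      Φ z.1 = Φ z.2 → ∃ k : ℤ, z.1 = z.2 + (k : ℂ) := by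
    intro s t
    have c1 : Tendsto (fun z : ℂ × ℂ => z.1) (𝓝 ((s : ℂ), (t : ℂ))) (𝓝 (s : ℂ)) :=
      continuous_fst.tendsto _
    have c2 : Tendsto (fun z : ℂ × ℂ => z.2) (𝓝 ((s : ℂ), (t : ℂ))) (𝓝 (t : ℂ)) :=
      continuous_snd.tendsto _
    -- Equal boundary points have parameters differing by an integer k, and translation by k reduces
    -- to local injectivity at s. Distinct ones stay distinct by continuity.
    by_cases hst : η s = η t
    · obtain ⟨k, hk⟩ := hη.eq_iff.1 hst
      obtain ⟨U, hU, hUinj⟩ := eventually_injOn_of_deriv_ne (han s) (hd0 s)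
      have c3 : Tendsto (fun z : ℂ × ℂ => z.2 + k) (𝓝 ((s : ℂ), (t : ℂ))) (𝓝 (s : ℂ)) := by
        have := c2.add_const (k : ℂ)
        rwa [show (t : ℂ) + (k : ℂ) = (s : ℂ) by rw [hk]; push_cast; rfl] at this
      filter_upwards [c1.eventually hU, c3.eventually hU, c2.eventually (hnhds t)]
        with z h1 h2 h3 hz
      refine ⟨k, hUinj h1 h2 ?_⟩
      rw [hz, periodic_strip_int hper h3]
    · have hne : Φ s ≠ Φ t := fun h0 => hst (by rw [← hΦη', ← hΦη', h0])
      have d1 := (han s).continuousAt.tendsto.comp c1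
      have d2 := (han t).continuousAt.tendsto.comp c2
      filter_upwards [(d1.prodMk_nhds d2).eventually
        (isOpen_ne_fun continuous_fst continuous_snd |>.mem_nhds hne)] with z hz hz'
      exact absurd hz' hz
  obtain ⟨δ₁, hδ₁, H₁⟩ := exists_strip_of_eventually hside
  obtain ⟨δ₂, hδ₂, H₂⟩ := exists_strip_of_eventually₂ hinj
  set ρ := min r (min δ₁ δ₂) with hρdef
  have hρ : 0 < ρ := lt_min hr0 (lt_min hδ₁ hδ₂)
  have s0 : strip ρ ⊆ strip r := strip_subset (min_le_left _ _)
  have s1 : strip ρ ⊆ strip δ₁ := strip_subset ((min_le_right _ _).trans (min_le_left _ _))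
  have s2 : strip ρ ⊆ strip δ₂ := strip_subset ((min_le_right _ _).trans (min_le_right _ _))
  have hfrac : ∀ z ∈ strip ρ, ∃ (k : ℤ) (w : ℂ), w ∈ strip ρ ∧ w.re ∈ Icc 0 1 ∧ z = w + k := by
    intro z hz
    refine ⟨⌊z.re⌋, z - ⌊z.re⌋, by simpa [strip] using hz, ?_, by ring⟩
    have : (z - (⌊z.re⌋ : ℂ)).re = Int.fract z.re := by simp
    rw [this]
    exact ⟨Int.fract_nonneg _, (Int.fract_lt_one _).le⟩
  have hdper : ∀ z ∈ strip r, ∀ k : ℤ, deriv Φ (z + k) = deriv Φ z := by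
    intro z hz k
    rw [← deriv_comp_add_const]
    refine Filter.EventuallyEq.deriv_eq ?_
    filter_upwards [(isOpen_strip r).mem_nhds hz] with w hw using periodic_strip_int hper hw k
  refine ⟨Φ, ρ, ⟨hρ, hΦd.mono s0, ?_, ?_, ?_, ?_, ?_⟩, hΦη'⟩
  · intro z hz w hw
    constructor
    · intro hzw
      obtain ⟨k, z', hz', hzI, rfl⟩ := hfrac z hz
      obtain ⟨l, w', hw', hwI, rfl⟩ := hfrac w hw
      rw [periodic_strip_int hper (s0 hz'), periodic_strip_int hper (s0 hw')] at hzw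
      obtain ⟨j, hj⟩ := H₂ z' w' hzI hwI (s2 hz') (s2 hw') hzw
      refine ⟨j + k - l, ?_⟩
      have hj' : z' = w' + j := hj
      rw [hj']
      push_cast
      ring
    · rintro ⟨k, rfl⟩
      exact periodic_strip_int hper (s0 hw) k
  · intro z hz
    obtain ⟨k, z', hz', hzI, rfl⟩ := hfrac z hz
    rw [hdper z' (s0 hz')]
    exact (H₁ z' hzI (s1 hz')).2
  · intro z hz hpos
    obtain ⟨k, z', hz', hzI, rfl⟩ := hfrac z hz
    rw [periodic_strip_int hper (s0 hz')]
    exact (H₁ z' hzI (s1 hz')).1.1 (by simpa using hpos)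
  · intro z hz hneg
    obtain ⟨k, z', hz', hzI, rfl⟩ := hfrac z hz
    rw [periodic_strip_int hper (s0 hz')]
    exact (H₁ z' hzI (s1 hz')).1.2 (by simpa using hneg)
  · rw [← hr]
    congr 1
    exact funext hΦη'

lemma toPlane_I_mul (v : Plane) :
    toPlane (Complex.I * toPlane.symm v) = (-v 1) • unitVec 0 + v 0 • unitVec 1 := by
  obtain ⟨z, rfl⟩ := toPlane.surjective v
  rw [plane_eq_sum (toPlane _)]
  simp [toPlane_zero, toPlane_one]

/-- A Jordan parametrization of the boundary can be oriented positively. -/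
lemma exists_oriented {Ω : Set Plane} {a : Plane → ℝ} {x₀ : Plane} (h : IsFlux Ω a x₀)
    {η : ℝ → Plane} (hη : IsJordanParam ω η) (hr : range η = frontier Ω) :
    (∀ t, fderiv ℝ a (η t) (toPlane (Complex.I * toPlane.symm (deriv η t))) < 0) ∨
    (∀ t, fderiv ℝ a (η (-t))
      (toPlane (Complex.I * toPlane.symm (deriv (fun t => η (-t)) t))) < 0) := by
  have hfr : ∀ t, η t ∈ frontier Ω := fun t => hr ▸ mem_range_self t
  have hηan : ∀ t, AnalyticAt ℝ η t := fun t => hη.contDiff.contDiffAt.analyticAt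
  have haan : ∀ t, AnalyticAt ℝ a (η t) := fun t => h.analytic _ (frontier_subset_closure (hfr t))
  set o : ℝ → ℝ := fun t => fderiv ℝ a (η t) (toPlane (Complex.I * toPlane.symm (deriv η t)))
    with ho
  have hoc : Continuous o := by
    refine continuous_iff_continuousAt.2 fun t => ?_
    have h1 : ContinuousAt (fun t => fderiv ℝ a (η t)) t :=
      ContinuousAt.comp (g := fderiv ℝ a) (haan t).fderiv.continuousAt (hηan t).continuousAt
    have h2 : ContinuousAt (fun t => toPlane (Complex.I * toPlane.symm (deriv η t))) t :=
      toPlane.continuous.continuousAt.comp (continuousAt_const.mul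
        (toPlane.symm.continuous.continuousAt.comp (hηan t).deriv.continuousAt))
    exact h1.clm_apply h2
  -- da kills η', since a = 0 along the curve. If it killed i η' too, it would vanish on the
  -- boundary.
  have ho0 : ∀ t, o t ≠ 0 := by
    intro t h0
    have h1 : fderiv ℝ a (η t) (deriv η t) = 0 := by
      have hd := (haan t).differentiableAt.hasFDerivAt.comp_hasDerivAt t
        (hηan t).differentiableAt.hasDerivAt
      have hz : HasDerivAt (a ∘ η) 0 t := by
        have : a ∘ η = fun _ => 0 := funext fun s => h.zero _ (hfr s)
        rw [this]
        exact hasDerivAt_const t 0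
      exact hd.unique hz
    simp only [ho, toPlane_I_mul, map_add, map_smul, smul_eq_mul] at h0
    rw [clm_plane_apply] at h1
    simp only [smul_eq_mul] at h1
    have hv : (deriv η t 0) ^ 2 + (deriv η t 1) ^ 2 ≠ 0 := by
      intro hv
      apply hη.regular t
      rw [← norm_eq_zero, ← sq_eq_zero_iff, EuclideanSpace.norm_sq_eq, Fin.sum_univ_two]
      simpa using hv
    have e0 : fderiv ℝ a (η t) (unitVec 0) = 0 := by
      apply mul_left_cancel₀ hv
      linear_combination deriv η t 0 * h1 - deriv η t 1 * h0
    have e1 : fderiv ℝ a (η t) (unitVec 1) = 0 := by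
      apply mul_left_cancel₀ hv
      linear_combination deriv η t 1 * h1 + deriv η t 0 * h0
    apply h.regular_frontier (hfr t)
    ext w
    rw [clm_plane_apply, e0, e1]
    simp
  by_cases hneg : ∀ t, o t < 0
  · exact Or.inl hneg
  · right
    push Not at hneg
    intro t
    rw [deriv_comp_neg, map_neg, mul_neg, map_neg, map_neg, neg_lt_zero]
    by_contra hcon
    push Not at hcon
    obtain ⟨s, hs⟩ := mem_range_of_exists_le_of_exists_ge hoc ⟨-t, hcon⟩ hneg
    exact ho0 s hs

/-! ### The field of the current sheet -/

/-- The field which at `Φ z`, for `0 ≤ Im z < δ`, is the complex conjugate of `κ / Φ'(z)`, and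
vanishes elsewhere. Its field lines are the curves `Im z = const`. -/
def sheetField (Φ : ℂ → ℂ) (κ δ : ℝ) (x : Plane) : Plane :=
  open Classical in
  if h : ∃ z : ℂ, 0 ≤ z.im ∧ z.im < δ ∧ toPlane (Φ z) = x then
    toPlane (((κ / ‖deriv Φ h.choose‖ ^ 2 : ℝ) : ℂ) * deriv Φ h.choose)
  else 0

lemma sheetField_eq_zero {Φ : ℂ → ℂ} {κ δ : ℝ} {x : Plane}
    (h : ∀ z : ℂ, 0 ≤ z.im → z.im < δ → toPlane (Φ z) ≠ x) : sheetField Φ κ δ x = 0 := by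
  rw [sheetField, dif_neg]
  rintro ⟨z, h1, h2, h3⟩
  exact h z h1 h2 h3

lemma mem_strip_of_nonneg {r : ℝ} {z : ℂ} (h0 : 0 ≤ z.im) (h1 : z.im < r) : z ∈ strip r := by
  rw [strip, mem_ofPred_eq, abs_of_nonneg h0]
  exact h1

namespace IsCollar

variable {Ω : Set Plane} {Φ : ℂ → ℂ} {r : ℝ}

lemma differentiableAt (h : IsCollar Ω Φ r) {z : ℂ} (hz : z ∈ strip r) :
    DifferentiableAt ℂ Φ z :=
  h.differentiableOn.differentiableAt ((isOpen_strip r).mem_nhds hz)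

lemma analyticAt (h : IsCollar Ω Φ r) {z : ℂ} (hz : z ∈ strip r) : AnalyticAt ℂ Φ z :=
  h.differentiableOn.analyticAt ((isOpen_strip r).mem_nhds hz)

lemma add_int (h : IsCollar Ω Φ r) {z : ℂ} (hz : z ∈ strip r) (k : ℤ) : Φ (z + k) = Φ z :=
  (h.eq_iff _ (by simpa [strip] using hz) _ hz).2 ⟨k, rfl⟩

lemma deriv_add_int (h : IsCollar Ω Φ r) {z : ℂ} (hz : z ∈ strip r) (k : ℤ) :
    deriv Φ (z + k) = deriv Φ z := by
  rw [← deriv_comp_add_const]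
  refine Filter.EventuallyEq.deriv_eq ?_
  filter_upwards [(isOpen_strip r).mem_nhds hz] with w hw using h.add_int hw k

lemma continuousAt_toPlane (h : IsCollar Ω Φ r) {z : ℂ} (hz : z ∈ strip r) :
    ContinuousAt (fun z => toPlane (Φ z)) z :=
  toPlane.continuous.continuousAt.comp (h.differentiableAt hz).continuousAt

lemma map_nhds (h : IsCollar Ω Φ r) {z : ℂ} (hz : z ∈ strip r) :
    map (fun z => toPlane (Φ z)) (𝓝 z) = 𝓝 (toPlane (Φ z)) := by
  have h1 := (h.analyticAt hz).hasStrictDerivAt.map_nhds_eq (h.deriv_ne z hz)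
  change map (toPlane ∘ Φ) (𝓝 z) = _
  rw [← Filter.map_map, h1]
  exact toPlane.toHomeomorph.map_nhds_eq (Φ z)

lemma isOpen_image (h : IsCollar Ω Φ r) {U : Set ℂ} (hU : IsOpen U) (hs : U ⊆ strip r) :
    IsOpen ((fun z => toPlane (Φ z)) '' U) := by
  rw [isOpen_iff_mem_nhds]
  rintro _ ⟨z, hz, rfl⟩
  rw [← h.map_nhds (hs hz)]
  exact image_mem_map (hU.mem_nhds hz)

lemma frontier_mem (h : IsCollar Ω Φ r) (t : ℝ) : toPlane (Φ t) ∈ frontier Ω :=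
  h.boundary ▸ mem_range_self t

lemma exists_fract (h : IsCollar Ω Φ r) {z : ℂ} (hz : z ∈ strip r) :
    ∃ w : ℂ, w.re ∈ Ico 0 1 ∧ w.im = z.im ∧ Φ w = Φ z := by
  refine ⟨z - ⌊z.re⌋, ?_, by simp, ?_⟩
  · have : (z - (⌊z.re⌋ : ℂ)).re = Int.fract z.re := by simp
    rw [this]
    exact ⟨Int.fract_nonneg _, Int.fract_lt_one _⟩
  · have hz' : z - (⌊z.re⌋ : ℂ) ∈ strip r := by simpa [strip] using hz
    have := h.add_int hz' ⌊z.re⌋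
    rw [sub_add_cancel] at this
    exact this.symm

/-- The chosen preimage is immaterial: two preimages differ by an integer and Φ' is periodic. -/
lemma sheetField_apply (h : IsCollar Ω Φ r) {κ δ : ℝ} (hδ : δ ≤ r) {z : ℂ} (h0 : 0 ≤ z.im)
    (h1 : z.im < δ) :
    sheetField Φ κ δ (toPlane (Φ z))
      = toPlane (((κ / ‖deriv Φ z‖ ^ 2 : ℝ) : ℂ) * deriv Φ z) := by
  have hex : ∃ w : ℂ, 0 ≤ w.im ∧ w.im < δ ∧ toPlane (Φ w) = toPlane (Φ z) := ⟨z, h0, h1, rfl⟩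
  rw [sheetField, dif_pos hex]
  obtain ⟨c0, c1, c2⟩ := hex.choose_spec
  have hz := mem_strip_of_nonneg h0 (h1.trans_le hδ)
  have hw := mem_strip_of_nonneg c0 (c1.trans_le hδ)
  obtain ⟨k, hk⟩ := (h.eq_iff _ hw _ hz).1 (toPlane.injective c2)
  rw [hk, h.deriv_add_int hz]

lemma norm_sheetField (h : IsCollar Ω Φ r) {κ δ : ℝ} (hκ : 0 < κ) (hδ : δ ≤ r) {z : ℂ}
    (h0 : 0 ≤ z.im) (h1 : z.im < δ) :
    ‖sheetField Φ κ δ (toPlane (Φ z))‖ = κ / ‖deriv Φ z‖ := by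
  have hn : 0 < ‖deriv Φ z‖ :=
    norm_pos_iff.2 (h.deriv_ne z (mem_strip_of_nonneg h0 (h1.trans_le hδ)))
  rw [h.sheetField_apply hδ h0 h1, LinearIsometryEquiv.norm_map, norm_mul, Complex.norm_real,
    Real.norm_of_nonneg (by positivity)]
  field_simp

lemma continuousAt_density (h : IsCollar Ω Φ r) (κ : ℝ) {z : ℂ} (hz : z ∈ strip r) :
    ContinuousAt (fun z => toPlane (((κ / ‖deriv Φ z‖ ^ 2 : ℝ) : ℂ) * deriv Φ z)) z := by
  have hd : ContinuousAt (deriv Φ) z := (h.analyticAt hz).deriv.continuousAt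
  have hn : ‖deriv Φ z‖ ^ 2 ≠ 0 := pow_ne_zero _ (norm_ne_zero_iff.2 (h.deriv_ne z hz))
  exact toPlane.continuous.continuousAt.comp ((Complex.continuous_ofReal.continuousAt.comp
    (continuousAt_const.div (hd.norm.pow 2) hn)).mul hd)

/-- Nearby points outside Ω are images of points with Im ≥ 0, so the cut at the boundary is not seen
from outside. -/
lemma continuousWithinAt_sheetField (h : IsCollar Ω Φ r) (κ : ℝ) {δ : ℝ} (hδ : δ ≤ r) {z : ℂ}
    (h0 : 0 ≤ z.im) (h1 : z.im < δ) :
    ContinuousWithinAt (sheetField Φ κ δ) Ωᶜ (toPlane (Φ z)) := by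
  have hz := mem_strip_of_nonneg h0 (h1.trans_le hδ)
  rw [ContinuousWithinAt, nhdsWithin, ← h.map_nhds hz, ← map_inf_principal_preimage,
    tendsto_map'_iff, h.sheetField_apply hδ h0 h1]
  refine ((h.continuousAt_density κ hz).mono_left inf_le_left).congr' ?_
  have e1 : ∀ᶠ w in 𝓝 z, w ∈ strip r ∧ w.im < δ :=
    ((isOpen_strip r).eventually_mem hz).and
      (Complex.continuous_im.continuousAt.eventually_lt_const h1)
  rw [EventuallyEq, eventually_inf_principal]
  filter_upwards [e1] with w hw hwΩ
  have hw0 : 0 ≤ w.im := by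
    by_contra hneg
    exact hwΩ (h.inside w hw.1 (not_le.1 hneg))
  exact (h.sheetField_apply hδ hw0 hw.2).symm

/-- The closed collar between `∂Ω` and the curve `Im z = δ`. -/
lemma exists_isCompact (h : IsCollar Ω Φ r) {δ : ℝ} (hδ : δ < r) :
    ∃ C : Set Plane, IsCompact C ∧ ∀ x, x ∈ C ↔ ∃ z : ℂ, 0 ≤ z.im ∧ z.im ≤ δ ∧
      toPlane (Φ z) = x := by
  have hs : ∀ z : ℂ, 0 ≤ z.im → z.im ≤ δ → z ∈ strip r := fun z h0 h1 =>
    mem_strip_of_nonneg h0 (h1.trans_lt hδ)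
  refine ⟨(fun z => toPlane (Φ z)) '' (Icc 0 1 ×ℂ Icc 0 δ),
    (isCompact_Icc.reProdIm isCompact_Icc).image_of_continuousOn fun z hz => ?_, fun x => ?_⟩
  · obtain ⟨-, h0, h1⟩ := Complex.mem_reProdIm.1 hz
    exact (h.continuousAt_toPlane (hs z h0 h1)).continuousWithinAt
  · constructor
    · rintro ⟨z, hz, rfl⟩
      obtain ⟨-, h0, h1⟩ := Complex.mem_reProdIm.1 hz
      exact ⟨z, h0, h1, rfl⟩
    · rintro ⟨z, h0, h1, rfl⟩
      obtain ⟨w, hw, hwi, hwΦ⟩ := h.exists_fract (hs z h0 h1)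
      refine ⟨w, Complex.mem_reProdIm.2 ⟨⟨hw.1, hw.2.le⟩, ?_⟩, by simp only [hwΦ]⟩
      rw [hwi]
      exact ⟨h0, h1⟩

/-- The curve `Im z = δ`. -/
lemma isJordanParam (h : IsCollar Ω Φ r) {δ : ℝ} (h0 : 0 < δ) (hδ : δ < r) :
    IsJordanParam ∞ (fun s : ℝ => toPlane (Φ (s + δ * Complex.I))) ∧
    ∀ s : ℝ, deriv (fun s : ℝ => toPlane (Φ (s + δ * Complex.I))) s
      = toPlane (deriv Φ (s + δ * Complex.I)) := by
  have hs : ∀ s : ℝ, ((s : ℂ) + δ * Complex.I) ∈ strip r := fun s => by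
    refine mem_strip_of_nonneg ?_ ?_ <;> simp [h0.le, hδ]
  have hpath : ∀ s : ℝ, HasDerivAt (fun s : ℝ => (s : ℂ) + δ * Complex.I) 1 s := fun s => by
    simpa using ((hasDerivAt_id (s : ℂ)).comp_ofReal).add_const (δ * Complex.I)
  have hd : ∀ s : ℝ, deriv (fun s : ℝ => toPlane (Φ (s + δ * Complex.I))) s
      = toPlane (deriv Φ (s + δ * Complex.I)) := fun s => by
    have := hasDerivAt_toPlane_comp (z := fun s : ℝ => (s : ℂ) + δ * Complex.I)
      (h.differentiableAt (hs s)) (hpath s)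
    rw [one_mul] at this
    exact this.deriv
  refine ⟨IsJordanParam.of_eq_iff ?_ (fun s t => ?_) (fun s => ?_), hd⟩
  · rw [contDiff_iff_contDiffAt]
    intro s
    have h1 : AnalyticAt ℝ Φ (s + δ * Complex.I) := (h.analyticAt (hs s)).restrictScalars
    have h2 : AnalyticAt ℝ (fun s : ℝ => (s : ℂ) + δ * Complex.I) s :=
      (Complex.ofRealCLM.analyticAt s).add analyticAt_const
    have h3 : AnalyticAt ℝ (fun s : ℝ => Φ (s + δ * Complex.I)) s :=
      AnalyticAt.comp (g := Φ) h1 h2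
    exact (((toPlane.toContinuousLinearEquiv : ℂ →L[ℝ] Plane).analyticAt _).comp h3).contDiffAt
  · rw [toPlane.injective.eq_iff, h.eq_iff _ (hs s) _ (hs t)]
    refine exists_congr fun k => ?_
    constructor
    · intro hk
      simpa using congrArg Complex.re hk
    · rintro rfl
      push_cast
      ring
  · rw [hd]
    exact fun h0 => h.deriv_ne _ (hs s) (toPlane.injective (h0.trans (map_zero _).symm))

/-- No Jordan curve theorem is needed. Ω with the part Im z < δ of the collar is open and bounded,
and with the complement of its compact hull `closure Ω ∪ C` it covers the complement of the curve. A
component meeting the closure of Ω stays in the bounded piece. -/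
lemma surrounds (h : IsCollar Ω Φ r) (hΩ : IsOpen Ω) (hb : Bornology.IsBounded Ω) {δ : ℝ}
    (h0 : 0 < δ) (hδ : δ < r) :
    Surrounds (fun s : ℝ => toPlane (Φ (s + δ * Complex.I))) Ω := by
  obtain ⟨C, hC, hCmem⟩ := h.exists_isCompact hδ
  have hs : ∀ s : ℝ, ((s : ℂ) + δ * Complex.I) ∈ strip r := fun s => by
    refine mem_strip_of_nonneg ?_ ?_ <;> simp [h0.le, hδ]
  set Γ := range fun s : ℝ => toPlane (Φ (s + δ * Complex.I)) with hΓ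
  set S : Set ℂ := strip r ∩ {z | z.im < δ} with hS
  have hSo : IsOpen S :=
    (isOpen_strip r).inter (isOpen_lt Complex.continuous_im continuous_const)
  set V := Ω ∪ (fun z => toPlane (Φ z)) '' S with hV
  have hVo : IsOpen V := hΩ.union (h.isOpen_image hSo inter_subset_left)
  have hcl : closure Ω ⊆ V := by
    intro x hx
    by_cases hxΩ : x ∈ Ω
    · exact Or.inl hxΩ
    · have hxf : x ∈ frontier Ω := ⟨hx, by rwa [hΩ.interior_eq]⟩
      rw [← h.boundary] at hxf
      obtain ⟨t, rfl⟩ := hxf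
      exact Or.inr ⟨t, ⟨ofReal_mem_strip h.pos t, by simpa using h0⟩, rfl⟩
  have hVK : V ⊆ closure Ω ∪ C := by
    rintro x (hx | ⟨z, ⟨hz, hzδ⟩, rfl⟩)
    · exact Or.inl (subset_closure hx)
    · rcases lt_or_ge z.im 0 with hneg | hpos
      · exact Or.inl (subset_closure (h.inside z hz hneg))
      · exact Or.inr ((hCmem _).2 ⟨z, hpos, le_of_lt hzδ, rfl⟩)
  have hKc : IsCompact (closure Ω ∪ C) := hb.isCompact_closure.union hC
  have hcover : Γᶜ ⊆ V ∪ (closure Ω ∪ C)ᶜ := by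
    intro x hx
    by_cases hxK : x ∈ closure Ω ∪ C
    · left
      rcases hxK with hxc | hxC
      · exact hcl hxc
      · obtain ⟨z, hz0, hz1, rfl⟩ := (hCmem x).1 hxC
        rcases hz1.lt_or_eq with hlt | heq
        · exact Or.inr ⟨z, ⟨mem_strip_of_nonneg hz0 (hlt.trans hδ), hlt⟩, rfl⟩
        · refine absurd ⟨z.re, ?_⟩ hx
          simp only
          rw [← heq, Complex.re_add_im]
    · exact Or.inr hxK
  have hdisj : Disjoint V (closure Ω ∪ C)ᶜ :=
    disjoint_left.2 fun x hx hx' => hx' (hVK hx)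
  intro x hx
  have hxΓ : x ∉ Γ := by
    rintro ⟨s, rfl⟩
    exact h.outside _ (hs s) (by simpa using h0) hx
  refine ⟨hxΓ, hKc.isBounded.subset (subset_trans ?_ hVK)⟩
  exact isPreconnected_connectedComponentIn.subset_left_of_subset_union hVo
    hKc.isClosed.isOpen_compl hdisj ((connectedComponentIn_subset _ _).trans hcover)
    ⟨x, mem_connectedComponentIn hxΓ, hcl hx⟩

lemma continuousOn_sheetField (h : IsCollar Ω Φ r) (hΩ : IsOpen Ω) (hb : Bornology.IsBounded Ω)
    (κ : ℝ) {δ : ℝ} (h0 : 0 < δ) (hδ : δ < r) :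
    ContinuousOn (sheetField Φ κ δ)
      (Ωᶜ \ range fun s : ℝ => toPlane (Φ (s + δ * Complex.I))) := by
  obtain ⟨C, hC, hCmem⟩ := h.exists_isCompact hδ
  rintro x ⟨hxΩ, hxΓ⟩
  by_cases hx : ∃ z : ℂ, 0 ≤ z.im ∧ z.im < δ ∧ toPlane (Φ z) = x
  · obtain ⟨z, hz0, hz1, rfl⟩ := hx
    exact (h.continuousWithinAt_sheetField κ hδ.le hz0 hz1).mono sdiff_subset
  · have hxK : x ∈ (closure Ω ∪ C)ᶜ := by
      rintro (hxc | hxC)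
      · have hxf : x ∈ frontier Ω := ⟨hxc, by rwa [hΩ.interior_eq]⟩
        rw [← h.boundary] at hxf
        obtain ⟨t, rfl⟩ := hxf
        exact hx ⟨t, by simp, by simpa using h0, rfl⟩
      · obtain ⟨z, hz0, hz1, rfl⟩ := (hCmem x).1 hxC
        rcases hz1.lt_or_eq with hlt | heq
        · exact hx ⟨z, hz0, hlt, rfl⟩
        · refine hxΓ ⟨z.re, ?_⟩
          simp only
          rw [← heq, Complex.re_add_im]
    have hopen : IsOpen (closure Ω ∪ C)ᶜ :=
      (hb.isCompact_closure.union hC).isClosed.isOpen_compl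
    refine ContinuousAt.continuousWithinAt ?_
    refine (continuousAt_const (y := (0 : Plane))).congr ?_
    filter_upwards [hopen.mem_nhds hxK] with y hy
    refine (sheetField_eq_zero fun z hz0 hz1 hzy => hy (Or.inr ?_)).symm
    exact (hCmem y).2 ⟨z, hz0, hz1.le, hzy⟩

lemma tendsto_sheetField (h : IsCollar Ω Φ r) (κ : ℝ) {δ : ℝ} (hδ : δ < r) :
    Tendsto (sheetField Φ κ δ) (cocompact Plane) (𝓝 0) := by
  obtain ⟨C, hC, hCmem⟩ := h.exists_isCompact hδ
  refine tendsto_const_nhds.congr' ?_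
  filter_upwards [hC.compl_mem_cocompact] with y hy
  exact (sheetField_eq_zero fun z hz0 hz1 hzy => hy ((hCmem y).2 ⟨z, hz0, hz1.le, hzy⟩)).symm

/-- The field is even integrable there: it is bounded on the bounded open collar, by compactness of
one period, and zero elsewhere. -/
lemma locallyIntegrableOn_sheetField (h : IsCollar Ω Φ r) {κ : ℝ} (hκ : 0 < κ) {δ : ℝ}
    (hδ : δ < r) : LocallyIntegrableOn (sheetField Φ κ δ) (closure Ω)ᶜ := by
  obtain ⟨C, hC, hCmem⟩ := h.exists_isCompact hδ
  set S : Set ℂ := {z | 0 < z.im} ∩ {z | z.im < δ} with hS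
  have hSo : IsOpen S := (isOpen_lt continuous_const Complex.continuous_im).inter
    (isOpen_lt Complex.continuous_im continuous_const)
  have hSs : S ⊆ strip r := fun z hz => mem_strip_of_nonneg (le_of_lt hz.1) (lt_trans hz.2 hδ)
  set W := (fun z => toPlane (Φ z)) '' S with hW
  have hWo : IsOpen W := h.isOpen_image hSo hSs
  have hWC : W ⊆ C := by
    rintro _ ⟨z, hz, rfl⟩
    exact (hCmem _).2 ⟨z, le_of_lt hz.1, le_of_lt hz.2, rfl⟩
  have hWout : W ⊆ Ωᶜ := by
    rintro _ ⟨z, hz, rfl⟩ hzΩ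
    exact h.outside z (hSs hz) hz.1 (subset_closure hzΩ)
  have hcont : ContinuousOn (sheetField Φ κ δ) W := by
    rintro _ ⟨z, hz, rfl⟩
    exact (h.continuousWithinAt_sheetField κ hδ.le (le_of_lt hz.1) hz.2).mono hWout
  obtain ⟨M, hM⟩ := (isCompact_Icc.reProdIm isCompact_Icc :
    IsCompact (Icc (0 : ℝ) 1 ×ℂ Icc 0 δ)).exists_bound_of_continuousOn
    (f := fun z => κ / ‖deriv Φ z‖) (fun z hz => by
      obtain ⟨-, hz0, hz1⟩ := Complex.mem_reProdIm.1 hz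
      have hzs := mem_strip_of_nonneg hz0 (hz1.trans_lt hδ)
      exact (continuousAt_const.div (h.analyticAt hzs).deriv.continuousAt.norm
        (norm_ne_zero_iff.2 (h.deriv_ne z hzs))).continuousWithinAt)
  have hint : IntegrableOn (sheetField Φ κ δ) W := by
    refine IntegrableOn.of_bound ((measure_mono hWC).trans_lt hC.measure_lt_top)
      (hcont.aestronglyMeasurable hWo.measurableSet) M ?_
    refine (ae_restrict_iff' hWo.measurableSet).2 (Eventually.of_forall ?_)
    rintro _ ⟨z, hz, rfl⟩
    obtain ⟨w, hw, hwi, hwΦ⟩ := h.exists_fract (hSs hz)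
    have hw0 : 0 ≤ w.im := hwi ▸ le_of_lt hz.1
    have hw1 : w.im < δ := hwi ▸ hz.2
    simp only
    rw [← hwΦ, h.norm_sheetField hκ hδ.le hw0 hw1]
    exact (le_abs_self _).trans
      (hM w (Complex.mem_reProdIm.2 ⟨⟨hw.1, hw.2.le⟩, hw0, hw1.le⟩))
  have hint' : IntegrableOn (sheetField Φ κ δ) (closure Ω)ᶜ := by
    refine (hint.integrable_indicator hWo.measurableSet).integrableOn.congr_fun ?_
      isClosed_closure.measurableSet.compl
    intro x hx
    by_cases hxW : x ∈ W
    · exact indicator_of_mem hxW _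
    · rw [indicator_of_notMem hxW, sheetField_eq_zero]
      rintro z hz0 hz1 rfl
      rcases hz0.lt_or_eq with hlt | heq
      · exact hxW ⟨z, ⟨hlt, hz1⟩, rfl⟩
      · have : z = (z.re : ℂ) := Complex.ext (by simp) (by simp [← heq])
        rw [this] at hx
        exact hx (frontier_subset_closure (h.frontier_mem _))
  exact hint'.locallyIntegrableOn

end IsCollar

/-! ### Weak divergence and curl in conformal coordinates -/

lemma inner_gradPerp (b : Plane) (φ : Plane → ℝ) (x : Plane) :
    inner ℝ b (gradPerp φ x) = fderiv ℝ φ x (toPlane (-Complex.I * toPlane.symm b)) := by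
  obtain ⟨z, rfl⟩ := toPlane.surjective b
  rw [clm_plane_apply, toPlane_zero, toPlane_one]
  simp [EuclideanSpace.inner_eq_star_dotProduct, dotProduct, Fin.sum_univ_two,
    gradPerp_coord_zero, gradPerp_coord_one, toPlane_zero, toPlane_one]
  ring

lemma inner_gradient (b : Plane) (φ : Plane → ℝ) (x : Plane) :
    inner ℝ b (gradient φ x) = fderiv ℝ φ x b := by
  rw [real_inner_comm, inner_gradient_left]

lemma det_toSpanSingleton_complex (c : ℂ) :
    ((ContinuousLinearMap.toSpanSingleton ℂ c).restrictScalars ℝ).det = ‖c‖ ^ 2 := by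
  change LinearMap.det ((LinearMap.toSpanSingleton ℂ ℂ c).restrictScalars ℝ) = _
  rw [LinearMap.det_restrictScalars, Algebra.norm_complex_eq]
  simp [LinearMap.det_ring, Complex.normSq_eq_norm_sq]

lemma eq_zero_of_isTest {U : Set Plane} {φ : Plane → ℝ} (hφ : IsTest U φ) {x : Plane}
    (hx : x ∉ U) : φ x = 0 :=
  image_eq_zero_of_notMem_tsupport fun h => hx (hφ.support h)

namespace IsCollar

variable {Ω : Set Plane} {Φ : ℂ → ℂ} {r : ℝ}

/-- The action of the field on a gradient, in the conformal coordinates of the collar. -/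
lemma integral_sheetField (h : IsCollar Ω Φ r) (κ : ℝ) {δ : ℝ} (hδ : δ < r)
    (v : ℂ) {φ : Plane → ℝ} :
    ∫ x, fderiv ℝ φ x (toPlane (v * toPlane.symm (sheetField Φ κ δ x)))
      = κ * ∫ q in Ico (0 : ℝ) 1 ×ˢ Ico (0 : ℝ) δ,
          fderiv ℝ φ (toPlane (Φ (q.1 + q.2 * Complex.I)))
            (toPlane (v * deriv Φ (q.1 + q.2 * Complex.I))) := by
  -- Change of variables x = Φ(z) over the half-open rectangle [0, 1) × [0, δ), where Φ is
  -- injective. The Jacobian |Φ'|² cancels the weight 1/|Φ'|² of the field.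
  set g : Plane → ℝ := fun x =>
    fderiv ℝ φ x (toPlane (v * toPlane.symm (sheetField Φ κ δ x))) with hg
  set R : Set ℂ := Ico (0 : ℝ) 1 ×ℂ Ico 0 δ with hR
  have hRm : MeasurableSet R :=
    (measurableSet_Ico.preimage Complex.measurable_re).inter
      (measurableSet_Ico.preimage Complex.measurable_im)
  have hRs : ∀ z ∈ R, z ∈ strip r := fun z hz => by
    obtain ⟨-, hz0, hz1⟩ := Complex.mem_reProdIm.1 hz
    exact mem_strip_of_nonneg hz0 (hz1.trans hδ)
  have hinj : InjOn Φ R := by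
    intro z hz w hw hzw
    obtain ⟨k, hk⟩ := (h.eq_iff z (hRs z hz) w (hRs w hw)).1 hzw
    obtain ⟨⟨hz0, hz1⟩, -⟩ := Complex.mem_reProdIm.1 hz
    obtain ⟨⟨hw0, hw1⟩, -⟩ := Complex.mem_reProdIm.1 hw
    have hre : z.re = w.re + k := by simpa using congrArg Complex.re hk
    have h1 : (k : ℝ) < 1 := by linarith
    have h2 : (-1 : ℝ) < k := by linarith
    have h1' : k < 1 := by exact_mod_cast h1
    have h2' : -1 < k := by exact_mod_cast h2
    have : k = 0 := by lia
    simpa [this] using hk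
  have hgzero : ∀ w ∉ Φ '' R, g (toPlane w) = 0 := by
    intro w hw
    have : sheetField Φ κ δ (toPlane w) = 0 := by
      refine sheetField_eq_zero fun z hz0 hz1 hzw => hw ?_
      obtain ⟨y, hy, hyi, hyΦ⟩ := h.exists_fract (mem_strip_of_nonneg hz0 (hz1.trans hδ))
      exact ⟨y, Complex.mem_reProdIm.2 ⟨hy, hyi ▸ hz0, hyi ▸ hz1⟩,
        hyΦ.trans (toPlane.injective hzw)⟩
    simp [hg, this]
  have e1 : ∫ x, g x = ∫ w, g (toPlane w) :=
    (toPlane.measurePreserving.integral_comp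
      toPlane.toHomeomorph.measurableEmbedding g).symm
  have e2 : ∫ w, g (toPlane w) = ∫ w in Φ '' R, g (toPlane w) :=
    (setIntegral_eq_integral_of_forall_compl_eq_zero hgzero).symm
  have e3 := integral_image_eq_integral_abs_det_fderiv_smul volume hRm
    (f' := fun z => (ContinuousLinearMap.toSpanSingleton ℂ (deriv Φ z)).restrictScalars ℝ)
    (fun z hz => ((h.differentiableAt
      (hRs z hz)).hasDerivAt.hasFDerivAt.restrictScalars ℝ).hasFDerivWithinAt) hinj (fun w => g (toPlane w))
  have e4 : ∫ z in R, |((ContinuousLinearMap.toSpanSingleton ℂ (deriv Φ z)).restrictScalars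
        ℝ).det| • g (toPlane (Φ z))
      = ∫ z in R, κ * fderiv ℝ φ (toPlane (Φ z)) (toPlane (v * deriv Φ z)) := by
    refine setIntegral_congr_fun hRm fun z hz => ?_
    obtain ⟨-, hz0, hz1⟩ := Complex.mem_reProdIm.1 hz
    have hn : ‖deriv Φ z‖ ≠ 0 := norm_ne_zero_iff.2 (h.deriv_ne z (hRs z hz))
    simp only [hg]
    rw [det_toSpanSingleton_complex, h.sheetField_apply hδ.le hz0 hz1, LinearIsometryEquiv.symm_apply_apply,
      abs_of_nonneg (by positivity), mul_left_comm, ← Complex.real_smul, map_smul, map_smul,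
      smul_eq_mul, smul_eq_mul]
    field_simp
  have e5 : ∫ z in R, fderiv ℝ φ (toPlane (Φ z)) (toPlane (v * deriv Φ z))
      = ∫ q in Ico (0 : ℝ) 1 ×ˢ Ico (0 : ℝ) δ,
          fderiv ℝ φ (toPlane (Φ (q.1 + q.2 * Complex.I)))
            (toPlane (v * deriv Φ (q.1 + q.2 * Complex.I))) := by
    rw [← Complex.volume_preserving_equiv_real_prod.setIntegral_preimage_emb
      Complex.measurableEquivRealProd.measurableEmbedding]
    refine integral_congr_ae (Eventually.of_forall fun z => ?_)
    simp only [Complex.measurableEquivRealProd_apply, Complex.re_add_im]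
  rw [e1, e2, e3, e4, integral_const_mul, e5]

lemma continuousOn_density (h : IsCollar Ω Φ r) {δ : ℝ} (hδ : δ < r) (v : ℂ) {φ : Plane → ℝ}
    (hφ : ContDiff ℝ ∞ φ) :
    ContinuousOn (fun q : ℝ × ℝ => fderiv ℝ φ (toPlane (Φ (q.1 + q.2 * Complex.I)))
      (toPlane (v * deriv Φ (q.1 + q.2 * Complex.I)))) (Icc (0 : ℝ) 1 ×ˢ Icc (0 : ℝ) δ) := by
  rintro ⟨s, τ⟩ ⟨-, hτ0, hτ1⟩
  have hz : ((s : ℂ) + τ * Complex.I) ∈ strip r :=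
    mem_strip_of_nonneg (by simpa using hτ0) (by simpa using hτ1.trans_lt hδ)
  have hp : ContinuousAt (fun q : ℝ × ℝ => (q.1 : ℂ) + q.2 * Complex.I) (s, τ) := by fun_prop
  have h1 : ContinuousAt (fun z => fderiv ℝ φ (toPlane (Φ z))) ((s : ℂ) + τ * Complex.I) :=
    (hφ.continuous_fderiv (by simp)).continuousAt.comp (h.continuousAt_toPlane hz)
  have h2 : ContinuousAt (fun z => toPlane (v * deriv Φ z)) ((s : ℂ) + τ * Complex.I) :=
    toPlane.continuous.continuousAt.comp
      (continuousAt_const.mul (h.analyticAt hz).deriv.continuousAt)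
  have h3 := h1.clm_apply h2
  have h4 := h3.comp_of_eq hp rfl
  exact h4.continuousWithinAt

/-- The transformed integrand is ∂_s of φ(Φ(s + iτ)), whose integral over a period is zero for each
τ. -/
lemma div_sheetField (h : IsCollar Ω Φ r) (κ : ℝ) {δ : ℝ} (hδ : δ < r)
    {φ : Plane → ℝ} (hφ : ContDiff ℝ ∞ φ) :
    ∫ x, inner ℝ (sheetField Φ κ δ x) (gradient φ x) = 0 := by
  have e1 := h.integral_sheetField κ hδ 1 (φ := φ)
  simp only [one_mul, LinearIsometryEquiv.apply_symm_apply] at e1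
  simp only [inner_gradient, e1]
  have hc := h.continuousOn_density hδ 1 hφ
  simp only [one_mul] at hc
  set k : ℝ × ℝ → ℝ := fun q => fderiv ℝ φ (toPlane (Φ (q.1 + q.2 * Complex.I)))
      (toPlane (deriv Φ (q.1 + q.2 * Complex.I))) with hk
  have hint : IntegrableOn k (Ico (0 : ℝ) 1 ×ˢ Ico (0 : ℝ) δ) :=
    (hc.integrableOn_compact (isCompact_Icc.prod isCompact_Icc)).mono_set
      (prod_mono Ico_subset_Icc_self Ico_subset_Icc_self)
  rw [Measure.volume_eq_prod] at hint ⊢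
  change κ * ∫ q in Ico (0 : ℝ) 1 ×ˢ Ico (0 : ℝ) δ, k q ∂(volume.prod volume) = 0
  rw [← setIntegral_prod_swap, setIntegral_prod (fun q => k q.swap) hint.swap]
  refine mul_eq_zero_of_right _ (setIntegral_eq_zero_of_forall_eq_zero fun τ hτ => ?_)
  have hs : ∀ s : ℝ, ((s : ℂ) + τ * Complex.I) ∈ strip r := fun s =>
    mem_strip_of_nonneg (by simpa using hτ.1) (by simpa using hτ.2.trans hδ)
  have hpath : ∀ s : ℝ, HasDerivAt (fun s : ℝ => (s : ℂ) + τ * Complex.I) 1 s := fun s => by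
    simpa using ((hasDerivAt_id (s : ℂ)).comp_ofReal).add_const (τ * Complex.I)
  have hd : ∀ s : ℝ, HasDerivAt (fun s : ℝ => φ (toPlane (Φ (s + τ * Complex.I)))) (k (s, τ)) s :=
    fun s => by
      have := hasDerivAt_comp_path (f := φ) (z := fun s : ℝ => (s : ℂ) + τ * Complex.I)
        (hφ.differentiable (by simp)).differentiableAt (h.differentiableAt (hs s)) (hpath s)
      rwa [one_mul] at this
  have hki : IntervalIntegrable (fun s => k (s, τ)) volume 0 1 := by
    refine ContinuousOn.intervalIntegrable ?_
    rw [uIcc_of_le zero_le_one]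
    exact hc.comp (by fun_prop) fun s hs => ⟨hs, hτ.1, hτ.2.le⟩
  change ∫ s in Ico (0 : ℝ) 1, k (s, τ) = 0
  rw [integral_Ico_eq_integral_Ioc, ← intervalIntegral.integral_of_le zero_le_one,
    intervalIntegral.integral_eq_sub_of_hasDerivAt (fun s _ => hd s) hki, sub_eq_zero]
  have := h.add_int (hs 0) 1
  simp only [Complex.ofReal_zero, Int.cast_one] at this
  rw [Complex.ofReal_zero, Complex.ofReal_one, ← this]
  congr 3
  ring

/-- The transformed integrand is ∂_τ of φ(Φ(s + iτ)): the end τ = δ gives the sheet, and the end τ =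
0 vanishes with φ. -/
lemma curl_sheetField (h : IsCollar Ω Φ r) (κ : ℝ) {δ : ℝ} (h0 : 0 < δ) (hδ : δ < r)
    {φ : Plane → ℝ} (hφ : ContDiff ℝ ∞ φ) (hφ0 : ∀ x ∈ frontier Ω, φ x = 0) :
    -∫ x, inner ℝ (sheetField Φ κ δ x) (gradPerp φ x)
      = κ * ∫ s in (0 : ℝ)..1, φ (toPlane (Φ (s + δ * Complex.I))) := by
  have e1 := h.integral_sheetField κ hδ (-Complex.I) (φ := φ)
  simp only [inner_gradPerp, e1]
  have hc := h.continuousOn_density hδ Complex.I hφ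
  simp only [neg_mul, map_neg]
  rw [integral_neg, mul_neg, neg_neg]
  set k : ℝ × ℝ → ℝ := fun q => fderiv ℝ φ (toPlane (Φ (q.1 + q.2 * Complex.I)))
      (toPlane (Complex.I * deriv Φ (q.1 + q.2 * Complex.I))) with hk
  have hint : IntegrableOn k (Ico (0 : ℝ) 1 ×ˢ Ico (0 : ℝ) δ) :=
    (hc.integrableOn_compact (isCompact_Icc.prod isCompact_Icc)).mono_set
      (prod_mono Ico_subset_Icc_self Ico_subset_Icc_self)
  rw [Measure.volume_eq_prod] at hint ⊢
  rw [setIntegral_prod _ hint, intervalIntegral.integral_of_le zero_le_one,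
    ← integral_Ico_eq_integral_Ioc]
  congr 1
  refine setIntegral_congr_fun measurableSet_Ico fun s hs => ?_
  have hτs : ∀ τ ∈ Icc (0 : ℝ) δ, ((s : ℂ) + τ * Complex.I) ∈ strip r := fun τ hτ =>
    mem_strip_of_nonneg (by simpa using hτ.1) (by simpa using hτ.2.trans_lt hδ)
  have hpath : ∀ τ : ℝ, HasDerivAt (fun τ : ℝ => (s : ℂ) + τ * Complex.I) Complex.I τ :=
    fun τ => by
      simpa using ((hasDerivAt_id (τ : ℂ)).comp_ofReal.mul_const Complex.I).const_add (s : ℂ)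
  have hd : ∀ τ ∈ Icc (0 : ℝ) δ,
      HasDerivAt (fun τ : ℝ => φ (toPlane (Φ (s + τ * Complex.I)))) (k (s, τ)) τ := fun τ hτ =>
    hasDerivAt_comp_path (f := φ) (z := fun τ : ℝ => (s : ℂ) + τ * Complex.I)
      (hφ.differentiable (by simp)).differentiableAt (h.differentiableAt (hτs τ hτ)) (hpath τ)
  have hki : IntervalIntegrable (fun τ => k (s, τ)) volume 0 δ := by
    refine ContinuousOn.intervalIntegrable ?_
    rw [uIcc_of_le h0.le]
    exact hc.comp (by fun_prop) fun τ hτ => ⟨⟨hs.1, hs.2.le⟩, hτ⟩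
  rw [integral_Ico_eq_integral_Ioc, ← intervalIntegral.integral_of_le h0.le,
    intervalIntegral.integral_eq_sub_of_hasDerivAt
      (fun τ hτ => hd τ (by rwa [uIcc_of_le h0.le] at hτ)) hki]
  have : φ (toPlane (Φ (s + (0 : ℝ) * Complex.I))) = 0 := by
    rw [Complex.ofReal_zero, zero_mul, add_zero]
    exact hφ0 _ (h.frontier_mem s)
  rw [this, sub_zero]

/-- The field of a current sheet that shields the exterior. -/
theorem exists_field (h : IsCollar Ω Φ r) (hΩ : IsOpen Ω) (hb : Bornology.IsBounded Ω) {κ : ℝ}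
    (hκ : 0 < κ) :
    ∃ (γ : ℝ → Plane) (j : Plane → ℝ) (Bext : Plane → Plane),
      IsJordanParam ∞ γ ∧ Surrounds γ Ω ∧ ContinuousOn j (range γ) ∧
      IsFieldOfCurrentSheet Ω γ j Bext ∧
      ∀ t : ℝ, Bext (toPlane (Φ t)) = toPlane (((κ / ‖deriv Φ t‖ ^ 2 : ℝ) : ℂ) * deriv Φ t) := by
  obtain ⟨δ, h0, hδ⟩ := exists_between h.pos
  have him : ∀ s : ℝ, ((s : ℂ) + δ * Complex.I).im = δ := fun s => by simp
  have hs : ∀ s : ℝ, ((s : ℂ) + δ * Complex.I) ∈ strip r := fun s =>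
    mem_strip_of_nonneg (by rw [him]; exact h0.le) (by rw [him]; exact hδ)
  obtain ⟨hJ, hd⟩ := h.isJordanParam h0 hδ
  -- The current density is the jump κ/|Φ'|. It is taken from the field of cut-off r, because the
  -- field of cut-off δ already vanishes on Im z = δ.
  refine ⟨fun s => toPlane (Φ (s + δ * Complex.I)), fun x => ‖sheetField Φ κ r x‖,
    sheetField Φ κ δ, hJ, h.surrounds hΩ hb h0 hδ, ?_, ⟨h.continuousOn_sheetField hΩ hb κ h0 hδ,
      h.locallyIntegrableOn_sheetField hκ hδ, fun φ hφ => ?_, fun φ hφ => ?_,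
      h.tendsto_sheetField κ hδ⟩, fun t => ?_⟩
  · rintro _ ⟨s, rfl⟩
    refine ((h.continuousWithinAt_sheetField κ le_rfl (by rw [him]; exact h0.le)
      (by rw [him]; exact hδ)).mono ?_).norm
    rintro _ ⟨t, rfl⟩ ht
    exact h.outside _ (hs t) (by rw [him]; exact h0) (subset_closure ht)
  · rw [h.curl_sheetField κ h0 hδ hφ.smooth, currentSheet, ← intervalIntegral.integral_const_mul]
    · refine intervalIntegral.integral_congr fun s _ => ?_
      have hn : ‖deriv Φ (s + δ * Complex.I)‖ ≠ 0 := norm_ne_zero_iff.2 (h.deriv_ne _ (hs s))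
      rw [hd, h.norm_sheetField hκ le_rfl (by rw [him]; exact h0.le) (by rw [him]; exact hδ),
        LinearIsometryEquiv.norm_map]
      field_simp
    · exact fun x hx => eq_zero_of_isTest hφ (fun hx' => hx' (frontier_subset_closure hx))
  · rw [h.div_sheetField κ hδ hφ.smooth, neg_zero]
  · exact h.sheetField_apply hδ.le (by simp) (by simpa using h0)

end IsCollar

/-! ### The free-boundary equilibrium -/

/-- A positive boundary pressure is balanced by the field of a surrounding current sheet. -/
theorem IsFlux.exists_equilibrium {Ω : Set Plane} (hΩ : IsAnalyticDomain Ω) {a : Plane → ℝ}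
    {x₀ : Plane} (h : IsFlux Ω a x₀) {u B : Plane → Plane} {p : Plane → ℝ}
    (hp : AnalyticOnNhd ℝ p (closure Ω)) (hpos : ∀ x ∈ frontier Ω, 0 < p x)
    (hsol : IsFixedBoundarySolution Ω u B p) :
    ∃ (γ : ℝ → Plane) (j : Plane → ℝ) (Bext : Plane → Plane),
      IsJordanParam ∞ γ ∧ Surrounds γ Ω ∧ ContinuousOn j (range γ) ∧
      IsFieldOfCurrentSheet Ω γ j Bext ∧ IsFreeBoundaryEquilibrium Ω u B p Bext := by
  obtain ⟨γ₀, hγ₀, hr₀⟩ := hΩ.boundary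
  have hfr₀ : ∀ t, γ₀ t ∈ frontier Ω := fun t => hr₀ ▸ mem_range_self t
  -- The weight √(2p) is dictated by pressure balance, as the field will have size κ/|η'|.
  -- Positivity of p makes the square root analytic.
  obtain ⟨η₀, κ, hη₀, hrη₀, hκ, hspeed₀⟩ := hγ₀.exists_reparam
    (m := fun x => √(2 * p x)) (fun t => Real.sqrt_pos.2 (by have := hpos _ (hfr₀ t); linarith))
    (fun t => by
      have h1 : AnalyticAt ℝ (fun t => 2 * p (γ₀ t)) t :=
        analyticAt_const.mul ((hp _ (frontier_subset_closure (hfr₀ t))).comp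
          hγ₀.contDiff.contDiffAt.analyticAt)
      have h2 : 2 * p (γ₀ t) ≠ 0 := by have := hpos _ (hfr₀ t); linarith
      exact ((h1.contDiffAt (n := ω)).sqrt h2).analyticAt)
  rw [hr₀] at hrη₀
  have hη : ∃ η : ℝ → Plane, IsJordanParam ω η ∧ range η = frontier Ω ∧
      (∀ s, ‖deriv η s‖ * √(2 * p (η s)) = κ) ∧
      ∀ t, fderiv ℝ a (η t) (toPlane (Complex.I * toPlane.symm (deriv η t))) < 0 := by
    rcases exists_oriented h hη₀ hrη₀ with ho | ho
    · exact ⟨η₀, hη₀, hrη₀, hspeed₀, ho⟩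
    · refine ⟨fun t => η₀ (-t), hη₀.reverse, ?_, fun s => ?_, ho⟩
      · rw [← hrη₀]
        exact neg_surjective.range_comp η₀
      · rw [deriv_comp_neg, norm_neg]
        exact hspeed₀ (-s)
  obtain ⟨η, hJ, hr, hspeed, hor⟩ := hη
  have hfr : ∀ t, η t ∈ frontier Ω := fun t => hr ▸ mem_range_self t
  obtain ⟨Φ, r, hc, hΦη⟩ := exists_collar h hJ hr hor
  obtain ⟨γ, j, Bext, h1, h2, h3, h4, hB⟩ := hc.exists_field hΩ.isOpen hΩ.bounded hκ
  have hderiv : ∀ t : ℝ, toPlane (deriv Φ t) = deriv η t := by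
    intro t
    have h1 := hasDerivAt_toPlane_comp (z := fun s : ℝ => (s : ℂ)) (v := 1)
      (hc.differentiableAt (ofReal_mem_strip hc.pos t))
      (by simpa using (hasDerivAt_id (t : ℂ)).comp_ofReal)
    simp only [hΦη, one_mul] at h1
    exact h1.deriv.symm
  have hBη : ∀ t : ℝ, Bext (η t) = (κ / ‖deriv η t‖ ^ 2) • deriv η t := by
    intro t
    rw [← hΦη, hB, ← hderiv, LinearIsometryEquiv.norm_map, ← map_smul, Complex.real_smul]
  have hpen : ∀ x ∈ frontier Ω, ∀ n, IsOutwardUnitNormal Ω x n → inner ℝ (Bext x) n = 0 := by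
    intro x hx n hn
    rw [← hr] at hx
    obtain ⟨t, rfl⟩ := hx
    refine h.inner_normal_eq_zero (hfr t) hn ?_
    have hd := (h.analytic _ (frontier_subset_closure
      (hfr t))).differentiableAt.hasFDerivAt.comp_hasDerivAt t
        (hJ.contDiff.differentiable (by simp) t).hasDerivAt
    have hz : HasDerivAt (a ∘ η) 0 t := by
      have : a ∘ η = fun _ => 0 := funext fun s => h.zero _ (hfr s)
      rw [this]
      exact hasDerivAt_const t 0
    rw [hBη, map_smul, hd.unique hz, smul_zero]
  refine ⟨γ, j, Bext, h1, h2, h3, h4, hsol.steady, fun x hx => ?_, fun x hx n hn => ?_, hpen,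
    hsol.u_tangent⟩
  · have hpx := hpos x hx
    rw [← hr] at hx
    obtain ⟨t, rfl⟩ := hx
    have hn : 0 < ‖deriv η t‖ := norm_pos_iff.2 (hJ.regular t)
    have hnorm : ‖Bext (η t)‖ = √(2 * p (η t)) := by
      rw [hBη, norm_smul, Real.norm_of_nonneg (by positivity), ← hspeed t]
      field_simp
    rw [hnorm, Real.sq_sqrt (by linarith)]
    ring
  · rw [hsol.B_tangent x hx n hn, hpen x hx n hn]

end PlasmaMHD

end

open PlasmaMHD
theorem theorem2p5 (Ω : Set Plane) (hΩ : IsAnalyticDomain Ω)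
    (A ψ p : Plane → ℝ)
    (hA : AnalyticOnNhd ℝ A (closure Ω)) (hψ : AnalyticOnNhd ℝ ψ (closure Ω))
    (hp : AnalyticOnNhd ℝ p (closure Ω))
    (hsol : IsFixedBoundarySolution Ω (gradPerp ψ) (gradPerp A) p)
    (hA0 : ∀ x ∈ frontier Ω, A x = 0)
    (hnull : ∃! x, x ∈ closure Ω ∧ gradPerp A x = 0) :
    (∃ G H : ℝ → ℝ, IsProfile Ω A ψ p G H) ∧
    ∀ G H : ℝ → ℝ, IsProfile Ω A ψ p G H →
      (∀ x ∈ frontier Ω, -2 * H 0 < (1 - |deriv G 0| ^ 2) * ‖gradPerp A x‖ ^ 2) →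
      ∃ (γ : ℝ → Plane) (j : Plane → ℝ) (Bext : Plane → Plane),
        IsJordanParam ∞ γ ∧ Surrounds γ Ω ∧ ContinuousOn j (range γ) ∧
        IsFieldOfCurrentSheet Ω γ j Bext ∧
        IsFreeBoundaryEquilibrium Ω (gradPerp ψ) (gradPerp A) p Bext := by
  obtain ⟨x₀, h⟩ := exists_isFlux hΩ hA hA0 hnull
  have hcrit : fderiv ℝ A x₀ = 0 := by
    rcases h with h | h
    · refine IsLocalMax.fderiv_eq_zero ?_
      filter_upwards [h.isOpen.mem_nhds h.mem] with y hy using h.isMaxOn (subset_closure hy)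
    · refine IsLocalMin.fderiv_eq_zero ?_
      filter_upwards [h.isOpen.mem_nhds h.mem] with y hy
      exact neg_le_neg_iff.1 (h.isMaxOn (subset_closure hy))
  refine ⟨exists_isProfile hΩ hA hψ hp hsol.steady h hcrit, fun G H hprof hineq => ?_⟩
  have hpos : ∀ x ∈ frontier Ω, 0 < p x := fun x hx =>
    pressure_pos h hprof hψ hx (hA0 x hx) (hineq x hx)
  rcases h with h | h
  · exact h.exists_equilibrium hΩ hp hpos hsol
  · exact h.exists_equilibrium hΩ hp hpos hsol
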